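/- Let $\mathcal L$ be a finite relational language all of whose relation symbols ("colours") are binary. An $\mathcal L$-structure $A$ is \emph{complete} if all its relations are symmetric and irreflexive and any two distinct elements of $A$ are related by exactly one relation. A \emph{triangle} is a complete structure on three points; it is determined up to isomorphism by the colours of its three edges, and we write e.g. $RXX$ for the triangle whose edges are coloured $R$, $X$, $X$ (the order of the letters being irrelevant). For a set $S$ of triangles, let $Forb_c(S)$ be the class of all finite complete $\mathcal L$-structures into which no triangle from $S$ embeds (as an induced substructure). Consider the following 28 sets $S$ of forbidden triangles (Cherlin's list). Language $\{R,G,X\}$: $\#1$: $RXX,\ GGX,\ XXX$. Language $\{R,G,X,Y\}$: $\#1$: $RXX,\ GYX,\ YXX$; $\#2$: $RXX,\ GYX,\ YXX,\ XXX$; $\#3$: $RXX,\ GYX,\ YXX,\ YYX$; $\#4$: $RXX,\ GYX,\ YXX,\ YYY$; $\#5$: $RXX,\ GYX,\ YXX,\ YYX,\ XXX$; $\#6$: $RXX,\ GYX,\ YXX,\ XXX,\ YYY$; $\#7$: $RXX,\ GYX,\ YXX,\ YYX,\ YYY$; $\#8$: $RXX,\ GYX,\ YXX,\ YYX,\ YYY,\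 XXX$; $\#9$: $RXX,\ GYX,\ YYX,\ XXX$; $\#10$: $RXX,\ GYX,\ YYX,\ XXX,\ YYY$; $\#11$: $RXX,\ GGX,\ YXX,\ XXX$; $\#12$: $RXX,\ GGX,\ YXX,\ XXX,\ YYX$; $\#13$: $RXX,\ GGX,\ YXX,\ XXX,\ YYY$; $\#14$: $RXX,\ GGX,\ YXX,\ YYX,\ XXX,\ YYY$; $\#15$: $RXX,\ GYX,\ GGX,\ YXX,\ XXX$; $\#16$: $RXX,\ GYX,\ GGX,\ YXX,\ XXX,\ YYX$; $\#17$: $RXX,\ GYX,\ GGX,\ YXX,\ XXX,\ YYY$; $\#18$: $RXX,\ GYX,\ GGX,\ YXX,\ YYX,\ XXX,\ YYY$; $\#19$: $RXX,\ GYX,\ GGX,\ YYX,\ XXX$; $\#20$: $RXX,\ GYX,\ GGX,\ YYX,\ XXX,\ YYY$; $\#21$: $RXX,\ RYY,\ GYX,\ YYX,\ XXX$; $\#22$: $RXX,\ RYY,\ GYX,\ YYX,\ YXX$; $\#23$: $RXX,\ RYY,\ GYX,\ YYX,\ YXX,\ XXX$; $\#24$: $RXX,\ RYY,\ GYX,\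 YXX,\ XXX,\ YYY$; $\#25$: $RXX,\ RYY,\ GYX,\ YXX,\ YYX,\ XXX,\ YYY$; $\#26$: $RRX,\ RXX,\ RYY,\ GYX,\ GXX,\ YYX,\ XXX$; $\#27$: $RRY,\ RRX,\ GYX,\ GXX,\ GYY,\ YYX,\ YXX,\ XXX,\ YYY$. \textbf{Theorem.} For each of these 28 sets $S$, the class $Forb_c(S)$ has a Fra\"iss\'e limit $\mathcal M_S$ (a countable homogeneous structure whose finite substructures are, up to isomorphism, exactly the members of $Forb_c(S)$; it is unique up to isomorphism), and the automorphism group $\mathrm{Aut}(\mathcal M_S)$ is a simple group. -/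

import Mathlib

universe u

open scoped FirstOrder
open FirstOrder (Language)
open FirstOrder.Language (IsFraisseLimit Structure)

/-- The composition group of automorphisms of a first-order structure. -/
instance automorphismGroup (L : Language) (M : Type u) [L.Structure M] : Group (M ≃[L] M) where
  mul f g := f.comp g
  one := Language.Equiv.refl L M
  inv f := f.symm
  mul_assoc _ _ _ := rfl
  one_mul _ := rfl
  mul_one _ := rfl
  inv_mul_cancel f := by
    apply Language.Equiv.ext
    intro x
    exact f.symm_apply_apply x

/-- The relation symbols of the language attached to a set `C` of colours:
one binary symbol for each colour. -/
inductive ColourRel (C : Type) : ℕ → Type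
  | edge : C → ColourRel C 2

/-- The relational language with one binary relation symbol for each colour in `C`. -/
def colourLanguage (C : Type) : Language := ⟨fun _ => Empty, ColourRel C⟩

instance colourLanguage_isRelational (C : Type) : (colourLanguage C).IsRelational :=
  fun _ => inferInstanceAs (IsEmpty Empty)

/-- The relation symbol of the colour `d`. -/
def colourSymbol {C : Type} (d : C) : (colourLanguage C).Relations 2 := ColourRel.edge d

/-- `HasColour A d x y`: the points `x`, `y` of the structure `A` are related by
the relation named `d`. -/
def HasColour {C : Type} (A : Type u) [(colourLanguage C).Structure A] (d : C) (x y : A) : Prop :=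
  Structure.RelMap (colourSymbol d) ![x, y]

/-- A complete structure: all relations are symmetric and irreflexive, and any two distinct
points are related by exactly one relation. -/
structure IsCompleteStructure (C : Type) (A : Type u) [(colourLanguage C).Structure A] :
    Prop where
  symm : ∀ (d : C) (x y : A), HasColour A d x y → HasColour A d y x
  irrefl : ∀ (d : C) (x : A), ¬ HasColour A d x x
  existsUnique_colour : ∀ x y : A, x ≠ y → ∃! d : C, HasColour A d x y

/-- The underlying set of the triangle with edge colours `t`: three points. -/
inductive Triangle {C : Type} (t : C × C × C) : Type
  | v₀ | v₁ | v₂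

/-- The triangle `t = (a, b, c)` as a structure: the complete structure on three points
`v₀, v₁, v₂` whose edges `{v₀, v₁}`, `{v₁, v₂}`, `{v₀, v₂}` have the colours `a`, `b`, `c`.
Permuting `a, b, c` gives an isomorphic structure, so a triangle is determined up to isomorphism
by its unordered triple of colours. -/
instance triangleStructure {C : Type} (t : C × C × C) :
    (colourLanguage C).Structure (Triangle t) where
  funMap f := nomatch f
  RelMap
    | .edge d => fun x =>
        (d = t.1 ∧ s(x 0, x 1) = s(.v₀, .v₁)) ∨
        (d = t.2.1 ∧ s(x 0, x 1) = s(.v₁, .v₂)) ∨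
        (d = t.2.2 ∧ s(x 0, x 1) = s(.v₀, .v₂))

/-- The class of all finite complete structures that do not embed any triangle from `S`. -/
def Forbc {C : Type} (S : Set (C × C × C)) :
    Set (CategoryTheory.Bundled.{u} (colourLanguage C).Structure) :=
  {A | Finite A ∧ IsCompleteStructure C A ∧
    ∀ t ∈ S, IsEmpty (Triangle t ↪[colourLanguage C] A)}

/-- The three colours `R`, `G`, `X`. -/
inductive Colour₃ : Type
  | R | G | X

/-- The four colours `R`, `G`, `X`, `Y`. -/
inductive Colour₄ : Type
  | R | G | X | Y

open Colour₃ in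
/-- The list of sets of forbidden triangles for the language with colours `R`, `G`, `X`. -/
def cherlinList₃ : List (Set (Colour₃ × Colour₃ × Colour₃)) :=
  [{(R, X, X), (G, G, X), (X, X, X)}]

open Colour₄ in
/-- The list of the sets of forbidden triangles, numbered from 1 to 27, for the language with
colours `R`, `G`, `X`, `Y`. -/
def cherlinList₄ : List (Set (Colour₄ × Colour₄ × Colour₄)) :=
  [{(R, X, X), (G, Y, X), (Y, X, X)},
   {(R, X, X), (G, Y, X), (Y, X, X), (X, X, X)},
   {(R, X, X), (G, Y, X), (Y, X, X), (Y, Y, X)},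
   {(R, X, X), (G, Y, X), (Y, X, X), (Y, Y, Y)},
   {(R, X, X), (G, Y, X), (Y, X, X), (Y, Y, X), (X, X, X)},
   {(R, X, X), (G, Y, X), (Y, X, X), (X, X, X), (Y, Y, Y)},
   {(R, X, X), (G, Y, X), (Y, X, X), (Y, Y, X), (Y, Y, Y)},
   {(R, X, X), (G, Y, X), (Y, X, X), (Y, Y, X), (Y, Y, Y), (X, X, X)},
   {(R, X, X), (G, Y, X), (Y, Y, X), (X, X, X)},
   {(R, X, X), (G, Y, X), (Y, Y, X), (X, X, X), (Y, Y, Y)},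
   {(R, X, X), (G, G, X), (Y, X, X), (X, X, X)},
   {(R, X, X), (G, G, X), (Y, X, X), (X, X, X), (Y, Y, X)},
   {(R, X, X), (G, G, X), (Y, X, X), (X, X, X), (Y, Y, Y)},
   {(R, X, X), (G, G, X), (Y, X, X), (Y, Y, X), (X, X, X), (Y, Y, Y)},
   {(R, X, X), (G, Y, X), (G, G, X), (Y, X, X), (X, X, X)},
   {(R, X, X), (G, Y, X), (G, G, X), (Y, X, X), (X, X, X), (Y, Y, X)},
   {(R, X, X), (G, Y, X), (G, G, X), (Y, X, X), (X, X, X), (Y, Y, Y)},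
   {(R, X, X), (G, Y, X), (G, G, X), (Y, X, X), (Y, Y, X), (X, X, X), (Y, Y, Y)},
   {(R, X, X), (G, Y, X), (G, G, X), (Y, Y, X), (X, X, X)},
   {(R, X, X), (G, Y, X), (G, G, X), (Y, Y, X), (X, X, X), (Y, Y, Y)},
   {(R, X, X), (R, Y, Y), (G, Y, X), (Y, Y, X), (X, X, X)},
   {(R, X, X), (R, Y, Y), (G, Y, X), (Y, Y, X), (Y, X, X)},
   {(R, X, X), (R, Y, Y), (G, Y, X), (Y, Y, X), (Y, X, X), (X, X, X)},
   {(R, X, X), (R, Y, Y), (G, Y, X), (Y, X, X), (X, X, X), (Y, Y, Y)},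
   {(R, X, X), (R, Y, Y), (G, Y, X), (Y, X, X), (Y, Y, X), (X, X, X), (Y, Y, Y)},
   {(R, R, X), (R, X, X), (R, Y, Y), (G, Y, X), (G, X, X), (Y, Y, X), (X, X, X)},
   {(R, R, Y), (R, R, X), (G, Y, X), (G, X, X), (G, Y, Y), (Y, Y, X), (Y, X, X), (X, X, X),
    (Y, Y, Y)}]

/-!
A countable homogeneous structure `M` whose points are joined by colours is handled through its
edge colouring `col`. For each of the sets `S` there are colours `p₁`, `p₂`, `p₃`, tried in this
order, such that two one-point extensions of a finite set `B` can be amalgamated by giving the new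
edge the first of these colours that creates no forbidden triangle over `B`: mostly `R`, `G`, with
variations for the last two sets. This is a finite check (`IsPrioritised`). It yields the existence
of the Fraïssé limit, point by point. Conversely every Fraïssé limit realises all types over finite
sets and is homogeneous (`IsGenericColouring`).

Say that `x` and `y` are independent over `B` if their edge has the preferred colour over `B`, or
one of them lies in `B`. The finite check also gives that this is a stationary independence relation
for the automorphism group `G`, which behaves as that of Tent and Ziegler, with a further property,
`mixing`: if `w₁, w₂, w₃, w₄` is a chain in which each point is independent from `x` over its
predecessor and `B`, then `w₄` is independent from `x` over `B`. The reason is that `w₂` is joined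
to `x` by one of `p₁`, `p₂`, `p₃`, and hence cannot block both `p₁` and `p₂` for the edge from `x`
to `w₃`; so `w₃` is independent from `x` over `B` or joined to it by `p₁` or `p₂`, and in either
case it does not influence the preferred colour of the edge from `x` to `w₄`.

Let `N` be a normal subgroup of `G` and let `g ≠ 1` belong to `N`.

* Every type over a finite set that is not realised in the set has a realisation moved by `g`
  (`IsGenericColouring.movesTypes`).
* Conjugates `g₀, …, g₃` of `g` are built by finite approximation so that, for each type over a
  finite set `X`, a realisation `z` of it is moved by `g₀`, its image by `g₁`, and so on, each image
  being as independent from `z` as possible. By `mixing`, the product `k` of the four conjugates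
  moves maximally: `z` and `k z` are independent over `X`, and over `k X`
  (`StationaryIndependence.MovesTypes.exists_mover`).
* Products of four conjugates of a maximally moving `k` realise many finite partial maps: once the
  conjugates are in general position on a finite chain of sets, their product can be changed to
  agree on any finite set with any automorphism that agrees with it on the first set of the chain
  (`exists_generalPosition`, `exists_conj_eqOn`). Applied alternately to two such products this
  back-and-forth represents each element of the pointwise stabiliser of some finite set as the
  quotient of two of them, hence `N` is open (`Mover.exists_prodConj_eq`).
* An open normal subgroup is everything: it contains the pointwise stabilisers of a finite set `Y`
  and of a generic copy of `Y`, and these generate `G` (`eq_top_of_fixer_le`).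
-/

open scoped Pointwise

/-! ### Stationary independence relations for group actions -/

/-- The pointwise stabiliser of a finite set. -/
abbrev fixer (G : Type*) {M : Type*} [Group G] [MulAction G M] (B : Finset M) : Subgroup G :=
  fixingSubgroup G (B : Set M)

/-- A stationary independence relation, in pairwise form, for a group `G` acting on `M`:
`Ind B x y` says that the points `x` and `y` are independent over the finite set `B`.
Independence of two sets over `B` means independence of all pairs, which is why monotonicity
can be asked for in the strong form `mono`.  Two points have the same type over `B` when they are
in the same orbit of the pointwise stabiliser of `B`.  The field `mixing` says that a chain in
which each point is independent from `x` over its predecessor and `B` becomes independent from `x`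
over `B` alone after three steps. -/
structure StationaryIndependence (G M : Type*) [Group G] [MulAction G M] [DecidableEq M] where
  /-- the relation: `x` and `y` are independent over `B` -/
  Ind : Finset M → M → M → Prop
  smul : ∀ (g : G) {B x y}, Ind B x y → Ind (g • B) (g • x) (g • y)
  symm : ∀ {B x y}, Ind B x y → Ind B y x
  of_mem : ∀ {B x y}, y ∈ B → Ind B x y
  mem_of_self : ∀ {B x}, Ind B x x → x ∈ B
  mono : ∀ {B B' x y}, B ⊆ B' → Ind B x y → Ind B' x y
  trans : ∀ {B B' x y}, (∀ b ∈ B', Ind B x b) → Ind B' x y → Ind B x y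
  exists_ind : ∀ (B D : Finset M) (x : M), ∃ g ∈ fixer G B, ∀ d ∈ D, Ind B (g • x) d
  stationary : ∀ {B D : Finset M} {x : M} {h : G}, h ∈ fixer G B → (∀ d ∈ D, Ind B x d) →
    (∀ d ∈ D, Ind B (h • x) d) → ∃ g ∈ fixer G (B ∪ D), g • x = h • x
  mixing : ∀ {B : Finset M} {x w₁ w₂ w₃ w₄ : M}, w₁ ≠ x →
    Ind (insert w₁ B) x w₂ → w₂ ∉ insert w₁ B →
    Ind (insert w₂ B) x w₃ → w₃ ∉ insert w₂ B →
    Ind (insert w₃ B) x w₄ → w₄ ∉ insert w₃ B → Ind B x w₄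

section Fixer

variable {G M : Type*} [Group G] [MulAction G M] {B B' : Finset M} {a b g : G} {x y : M}

theorem mem_fixer : a ∈ fixer G B ↔ ∀ b ∈ B, a • b = b := by
  simp [mem_fixingSubgroup_iff]

theorem fixer_anti (h : B ⊆ B') (ha : a ∈ fixer G B') : a ∈ fixer G B :=
  mem_fixer.2 fun b hb => mem_fixer.1 ha b (h hb)

theorem smul_eq_of_mem_fixer (ha : a ∈ fixer G B) (hx : x ∈ B) : a • x = x :=
  mem_fixer.1 ha x hx

theorem inv_smul_eq_of_mem_fixer (ha : a ∈ fixer G B) (hx : x ∈ B) : a⁻¹ • x = x :=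
  mem_fixer.1 (inv_mem ha) x hx

/-- The conjugate `a g a⁻¹`. -/
def cj (a g : G) : G := a * g * a⁻¹

theorem cj_cj (a b g : G) : cj a (cj b g) = cj (a * b) g := by
  simp [cj, mul_assoc]

theorem cj_inv (a g : G) : (cj a g)⁻¹ = cj a g⁻¹ := by
  simp [cj, mul_assoc]

theorem cj_smul (a g : G) (x : M) : cj a g • x = a • g • a⁻¹ • x := by
  simp [cj, mul_smul]

theorem cj_smul_of_fixer (ha : a ∈ fixer G B) (hx : x ∈ B) (hgx : g • x ∈ B) :
    cj a g • x = g • x := by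
  rw [cj_smul, inv_smul_eq_of_mem_fixer ha hx, smul_eq_of_mem_fixer ha hgx]

variable [DecidableEq M]

theorem smul_finset_eq_of_forall {a b : G} (h : ∀ x ∈ B, a • x = b • x) : a • B = b • B :=
  Finset.image_congr fun x hx => h x hx

theorem smul_finset_of_mem_fixer (ha : a ∈ fixer G B') (h : B ⊆ B') : a • B = B := by
  have := smul_finset_eq_of_forall (a := a) (b := 1) (B := B)
    (fun x hx => by rw [one_smul]; exact smul_eq_of_mem_fixer ha (h hx))
  rwa [one_smul] at this

theorem cj_smul_finset_of_fixer {A : Finset M} (ha : a ∈ fixer G B) (hx : A ⊆ B)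
    (hgx : g • A ⊆ B) : cj a g • A = g • A :=
  smul_finset_eq_of_forall fun _ hxA =>
    cj_smul_of_fixer ha (hx hxA) (hgx (Finset.smul_mem_smul_finset hxA))

end Fixer

namespace StationaryIndependence

variable {G M : Type*} [Group G] [MulAction G M] [DecidableEq M]
  (I : StationaryIndependence G M) {B B' X Y K Q E : Finset M} {x y z q : M} {a g h : G}

theorem of_mem_left (hx : x ∈ B) : I.Ind B x y := I.symm (I.of_mem hx)

theorem trans_left (h : ∀ b ∈ B', I.Ind B b y) (hxy : I.Ind B' x y) : I.Ind B x y :=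
  I.symm (I.trans (fun b hb => I.symm (h b hb)) (I.symm hxy))

theorem smul_fixer (ha : a ∈ fixer G B') (hB : B ⊆ B') (h : I.Ind B x y) :
    I.Ind B (a • x) (a • y) := by
  have := I.smul a h
  rwa [smul_finset_of_mem_fixer ha hB] at this

theorem trans_union (h : ∀ s ∈ B', I.Ind B x s) (hxy : I.Ind (B ∪ B') x y) : I.Ind B x y :=
  I.trans (fun b hb => (Finset.mem_union.1 hb).elim (fun hb => I.of_mem hb) (h b)) hxy

/-- Independence over `B` from points fixed by `a` is kept by `a`, when `a` fixes `B`. -/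
theorem smul_left (ha : a ∈ fixer G B') (hB : B ⊆ B') (hy : y ∈ B') (h : I.Ind B x y) :
    I.Ind B (a • x) y := by
  have := I.smul_fixer ha hB h
  rwa [smul_eq_of_mem_fixer ha hy] at this

/-- A finite set can be moved over `B` to be independent from any given finite set. -/
theorem exists_ind_finset (B S E : Finset M) :
    ∃ a ∈ fixer G B, ∀ s ∈ S, ∀ e ∈ E, I.Ind B (a • s) e := by
  induction S using Finset.induction_on with
  | empty => exact ⟨1, one_mem _, by simp⟩
  | insert s S _ ih =>
    obtain ⟨a, ha, hS⟩ := ih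
    obtain ⟨b, hb, hbs⟩ := I.exists_ind (B ∪ a • S) E (a • s)
    have hbB : b ∈ fixer G B := fixer_anti Finset.subset_union_left hb
    refine ⟨b * a, mul_mem hbB ha, fun s' hs' e he => ?_⟩
    rw [mul_smul]
    rcases Finset.mem_insert.1 hs' with rfl | hs'
    · refine I.symm (I.trans_union (fun c hc => ?_) (I.symm (hbs e he)))
      obtain ⟨s', hs', rfl⟩ := Finset.mem_smul_finset.1 hc
      exact I.symm (hS _ hs' _ he)
    · have : b • a • s' = a • s' := smul_eq_of_mem_fixer hb
        (Finset.mem_union_right _ (Finset.smul_mem_smul_finset hs'))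
      rw [this]
      exact hS _ hs' _ he

/-! ### Automorphisms that move maximally -/

/-- `k` moves maximally some realisation `z` of the type of `y` over `X`: the point `k z` is
independent from `X` and `z` over `k X`, and `z` is independent from `k X` and `k z` over `X`. -/
abbrev MoverAt (k : G) (X : Finset M) (y : M) : Prop :=
  ∃ s ∈ fixer G X,
    (I.Ind (k • X) (k • s • y) (s • y) ∧ ∀ x ∈ X, I.Ind (k • X) (k • s • y) x) ∧
    (I.Ind X (s • y) (k • s • y) ∧ ∀ x ∈ X, I.Ind X (s • y) (k • x))

/-- `k` moves maximally: it moves maximally some realisation of every type over a finite set. -/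
def Mover (k : G) : Prop :=
  ∀ (X : Finset M) (y : M), I.MoverAt k X y

variable {I}

theorem Mover.inv {k : G} (hk : I.Mover k) : I.Mover k⁻¹ := by
  intro X y
  obtain ⟨s, hs, ⟨h1, h2⟩, h3, h4⟩ := hk (k⁻¹ • X) (k⁻¹ • y)
  rw [smul_inv_smul] at h1 h2
  refine ⟨cj k s, mem_fixer.2 fun x hx => ?_, ?_, ?_⟩
  · rw [cj_smul, smul_eq_of_mem_fixer hs (Finset.smul_mem_smul_finset hx), smul_inv_smul]
  · rw [cj_smul, inv_smul_smul]
    refine ⟨h3, fun x hx => ?_⟩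
    simpa using h4 (k⁻¹ • x) (Finset.smul_mem_smul_finset hx)
  · rw [cj_smul, inv_smul_smul]
    exact ⟨h1, fun x hx => h2 _ (Finset.smul_mem_smul_finset hx)⟩

theorem Mover.conj {k : G} (hk : I.Mover k) (a : G) : I.Mover (cj a k) := by
  intro X y
  obtain ⟨s, hs, ⟨h1, h2⟩, h3, h4⟩ := hk (a⁻¹ • X) (a⁻¹ • y)
  have e : a • k • a⁻¹ • X = cj a k • X := (cj_smul a k X).symm
  have es : cj a s • y = a • s • a⁻¹ • y := cj_smul a s y
  have ek : ∀ x : M, cj a k • a • x = a • k • x := fun x => by rw [cj_smul, inv_smul_smul]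
  have h1' := I.smul a h1
  have h3' := I.smul a h3
  have h2' := fun x hx => I.smul a (h2 (a⁻¹ • x) hx)
  have h4' := fun x hx => I.smul a (h4 (a⁻¹ • x) hx)
  simp only [e, smul_inv_smul, Finset.smul_mem_smul_finset_iff, ← ek] at h1' h2' h3' h4'
  refine ⟨cj a s, mem_fixer.2 fun x hx => ?_, ?_, ?_⟩
  · rw [cj_smul, smul_eq_of_mem_fixer hs (Finset.smul_mem_smul_finset hx), smul_inv_smul]
  · rw [es]
    exact ⟨h1', h2'⟩
  · rw [es]
    exact ⟨h3', h4'⟩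

/-- If `q` is independent over `Q` from a finite set `K` that contains `Q` and `g Q`, then `g` can
be conjugated over `K` so that it takes `q` to a point independent over `g Q` from everything. -/
theorem Mover.exists_step (hg : I.Mover g) (hQ : Q ⊆ K) (hgQ : g • Q ⊆ K)
    (hq : ∀ k ∈ K, I.Ind Q q k) (E : Finset M) :
    ∃ a ∈ fixer G K, ∀ e ∈ E ∪ insert q K, I.Ind (g • Q) (cj a g • q) e := by
  obtain ⟨s, hs, ⟨h1, h2⟩, -, -⟩ := hg K q
  have hgz : ∀ k ∈ g • K, I.Ind (g • Q) (g • s • q) k := by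
    intro k hk
    obtain ⟨k, hk', rfl⟩ := Finset.mem_smul_finset.1 hk
    exact I.smul g (I.smul_left hs hQ hk' (hq k hk'))
  have hwK : ∀ k ∈ K, I.Ind (g • Q) (s⁻¹ • g • s • q) k := fun k hk =>
    I.smul_left (inv_mem hs) hgQ hk (I.trans hgz (h2 k hk))
  have hwq : I.Ind (g • Q) (s⁻¹ • g • s • q) q := by
    have := I.smul_fixer (inv_mem hs) hgQ (I.trans hgz h1)
    rwa [inv_smul_smul] at this
  obtain ⟨t, ht, htE⟩ := I.exists_ind (insert q K) E (s⁻¹ • g • s • q)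
  have htK : t ∈ fixer G K := fixer_anti (Finset.subset_insert _ _) ht
  have key : cj (t * s⁻¹) g • q = t • s⁻¹ • g • s • q := by
    simp only [cj, mul_smul, mul_inv_rev, inv_inv]
    rw [inv_smul_eq_of_mem_fixer ht (Finset.mem_insert_self _ _)]
  have hqK : ∀ e ∈ insert q K, I.Ind (g • Q) (t • s⁻¹ • g • s • q) e := by
    intro e he
    refine I.smul_left ht (hgQ.trans (Finset.subset_insert _ _)) he ?_
    rcases Finset.mem_insert.1 he with rfl | he
    exacts [hwq, hwK e he]
  refine ⟨t * s⁻¹, mul_mem htK (inv_mem hs), fun e he => ?_⟩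
  rw [key]
  rcases Finset.mem_union.1 he with he | he
  exacts [I.trans hqK (htE e he), hqK e he]

/-- As `Mover.exists_step`, with a prescribed image of the right type. -/
theorem Mover.exists_step_eq {u : G} (hg : I.Mover g) (hQ : Q ⊆ K) (hgQ : g • Q ⊆ K)
    (hq : ∀ k ∈ K, I.Ind Q q k) (hu : u ∈ fixer G (g • Q))
    (hq' : ∀ k ∈ insert q K, I.Ind (g • Q) (u • g • q) k) :
    ∃ a ∈ fixer G K, cj a g • q = u • g • q := by
  obtain ⟨a, ha, hw⟩ := hg.exists_step hQ hgQ hq ∅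
  rw [Finset.empty_union] at hw
  have h1 : g * (cj a g)⁻¹ ∈ fixer G (g • Q) := by
    rw [← inv_mem_iff, mem_fixer]
    intro b hb
    obtain ⟨b, hb', rfl⟩ := Finset.mem_smul_finset.1 hb
    rw [mul_inv_rev, inv_inv, mul_smul, inv_smul_smul]
    exact cj_smul_of_fixer ha (hQ hb') (hgQ hb)
  have h2 : (u * (g * (cj a g)⁻¹)) • cj a g • q = u • g • q := by
    simp [mul_smul]
  obtain ⟨v, hv, hvq⟩ := I.stationary (mul_mem hu h1) hw (by rw [h2]; exact hq')
  rw [h2] at hvq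
  refine ⟨v * a, mul_mem (fixer_anti (fun k hk => ?_) hv) ha, ?_⟩
  · exact Finset.mem_union_right _ (Finset.mem_insert_of_mem hk)
  · rw [← cj_cj, cj_smul, inv_smul_eq_of_mem_fixer hv, hvq]
    exact Finset.mem_union_right _ (Finset.mem_insert_self _ _)

/-- `Mover.exists_step` for finitely many points. -/
theorem Mover.exists_step_finset (hg : I.Mover g) (hX : X ⊆ K) (hgX : g • X ⊆ K)
    (hQ : ∀ q ∈ Q, ∀ k ∈ K, I.Ind X q k) (E : Finset M) :
    ∃ a ∈ fixer G K, ∀ q ∈ Q, ∀ e ∈ E, I.Ind (g • X) (cj a g • q) e := by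
  induction Q using Finset.induction_on generalizing E with
  | empty => exact ⟨1, one_mem _, by simp⟩
  | insert q Q _ ih =>
    obtain ⟨a, ha, hE⟩ := ih (fun q hq => hQ q (Finset.mem_insert_of_mem hq)) (insert q E)
    have hq := hQ q (Finset.mem_insert_self _ _)
    set c := cj a g with hc
    have hcX : c • X = g • X := cj_smul_finset_of_fixer ha hX hgX
    have hK : K ⊆ K ∪ Q ∪ c • Q := fun k hk => by simp [hk]
    obtain ⟨b, hb, hbE⟩ := (hg.conj a).exists_step (Q := X ∪ Q) (K := K ∪ Q ∪ c • Q) (q := q)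
      (by
        intro k hk
        rcases Finset.mem_union.1 hk with hk | hk
        · simp [hX hk]
        · simp [hk])
      (by
        rw [Finset.smul_finset_union, ← hc, hcX]
        exact Finset.union_subset (hgX.trans hK) Finset.subset_union_right)
      (by
        intro k hk
        rcases Finset.mem_union.1 hk with hk | hk
        · rcases Finset.mem_union.1 hk with hk | hk
          · exact I.mono Finset.subset_union_left (hq k hk)
          · exact I.of_mem (Finset.mem_union_right _ hk)
        · obtain ⟨k, hk', rfl⟩ := Finset.mem_smul_finset.1 hk
          refine I.mono Finset.subset_union_left
            (I.trans (B' := g • X) (fun b hb => hq b (hgX hb)) ?_)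
          exact I.symm (hE k hk' q (Finset.mem_insert_self _ _))) E
    refine ⟨b * a, mul_mem (fixer_anti hK hb) ha, fun q' hq' e he => ?_⟩
    rw [← cj_cj, ← hc]
    rcases Finset.mem_insert.1 hq' with rfl | hq'
    · have h := hbE e (Finset.mem_union_left _ he)
      rw [Finset.smul_finset_union, ← hc, hcX] at h
      refine I.symm (I.trans_union (fun s hs => ?_) (I.symm h))
      obtain ⟨s, hs', rfl⟩ := Finset.mem_smul_finset.1 hs
      exact I.symm (hE s hs' e (Finset.mem_insert_of_mem he))
    · rw [cj_smul_of_fixer hb (by simp [hq'])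
        (Finset.mem_union_right _ (Finset.smul_mem_smul_finset hq'))]
      exact hE q' hq' e (Finset.mem_insert_of_mem he)

/-- Four maximally moving automorphisms `c₀, …, c₃` can be conjugated over the points already
fixed so that they lead from `y₀` to a prescribed point `f y₀` of the right type, provided both
ends are independent from the next sets of the chain. -/
theorem exists_chain {c₀ c₁ c₂ c₃ f : G} {Y₀ Y₁ Y₂ Y₃ Y₄ : Finset M} {y₀ : M}
    (m₀ : I.Mover c₀) (m₁ : I.Mover c₁) (m₂ : I.Mover c₂) (m₃ : I.Mover c₃)
    (h₀ : c₀ • Y₀ = Y₁) (h₁ : c₁ • Y₁ = Y₂) (h₂ : c₂ • Y₂ = Y₃) (h₃ : c₃ • Y₃ = Y₄)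
    (hf : ∀ y ∈ Y₀, f • y = c₃ • c₂ • c₁ • c₀ • y)
    (hy₀ : ∀ k ∈ X ∪ Y₀ ∪ Y₁, I.Ind Y₀ y₀ k) (hy₄ : ∀ k ∈ X ∪ Y₃ ∪ Y₄, I.Ind Y₄ (f • y₀) k)
    (E : Finset M) :
    ∃ a₀ ∈ fixer G (X ∪ Y₀ ∪ Y₁), ∃ a₁ ∈ fixer G (X ∪ Y₁ ∪ Y₂), ∃ a₂ ∈ fixer G (X ∪ Y₂ ∪ Y₃),
    ∃ a₃ ∈ fixer G (X ∪ Y₃ ∪ Y₄), ∃ y₁ y₂ y₃ : M, cj a₀ c₀ • y₀ = y₁ ∧ cj a₁ c₁ • y₁ = y₂ ∧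
      cj a₂ c₂ • y₂ = y₃ ∧ cj a₃ c₃ • y₃ = f • y₀ ∧
      (∀ e ∈ E, I.Ind Y₁ y₁ e) ∧ ∀ e ∈ E, I.Ind Y₃ y₃ e := by
  have h₂' : c₂⁻¹ • Y₃ = Y₂ := by rw [← h₂, inv_smul_smul]
  have h₃' : c₃⁻¹ • Y₄ = Y₃ := by rw [← h₃, inv_smul_smul]
  obtain ⟨a₀, ha₀, hE₁⟩ := m₀.exists_step (Q := Y₀) (K := X ∪ Y₀ ∪ Y₁) (q := y₀)
    (by grind) (by rw [h₀]; grind) hy₀ (E ∪ X ∪ Y₁ ∪ Y₂)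
  obtain ⟨a₃, ha₃, hE₃⟩ := m₃.inv.exists_step (Q := Y₄) (K := X ∪ Y₃ ∪ Y₄) (q := f • y₀)
    (by grind) (by rw [h₃']; grind) hy₄ (E ∪ X ∪ Y₂ ∪ Y₃)
  rw [h₀] at hE₁
  rw [h₃'] at hE₃
  set y₁ := cj a₀ c₀ • y₀ with hy₁
  set y₃ := cj a₃ c₃⁻¹ • f • y₀ with hy₃
  have e₃ : cj a₃ c₃ • y₃ = f • y₀ := by rw [hy₃, ← cj_inv, smul_inv_smul]
  obtain ⟨t, ht, htE⟩ := I.exists_ind Y₂ (insert y₁ (insert y₃ (X ∪ Y₁ ∪ Y₂ ∪ Y₃))) (c₁ • y₁)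
  obtain ⟨a₁, ha₁, e₁⟩ := m₁.exists_step_eq (Q := Y₁) (K := X ∪ Y₁ ∪ Y₂) (q := y₁) (u := t)
    (by grind) (by rw [h₁]; grind) (fun k hk => hE₁ k (by grind)) (by rwa [h₁])
    (fun k hk => by rw [h₁]; exact htE k (by grind))
  -- `u` realises the fact that the two ways around the chain give the same type over `Y₂`
  let u := t * c₁ * cj a₀ c₀ * f⁻¹ * cj a₃ c₃ * c₂
  have hu : u ∈ fixer G Y₂ := by
    rw [mem_fixer]
    intro b hb
    obtain ⟨b, hb', rfl⟩ := Finset.mem_smul_finset.1 (h₁ ▸ hb)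
    obtain ⟨b, hb'', rfl⟩ := Finset.mem_smul_finset.1 (h₀ ▸ hb')
    have i₃ : c₂ • c₁ • c₀ • b ∈ Y₃ := h₂ ▸ Finset.smul_mem_smul_finset hb
    have i₄ : c₃ • c₂ • c₁ • c₀ • b ∈ Y₄ := h₃ ▸ Finset.smul_mem_smul_finset i₃
    simp only [u, mul_smul]
    rw [cj_smul_of_fixer ha₃ (by grind) (by grind), ← hf b hb'', inv_smul_smul,
      cj_smul_of_fixer ha₀ (by grind) (by grind), smul_eq_of_mem_fixer ht hb]
  have hu' : u • c₂⁻¹ • y₃ = t • c₁ • y₁ := by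
    simp only [u, mul_smul, smul_inv_smul]
    rw [e₃, inv_smul_smul]
  obtain ⟨a₂, ha₂, e₂⟩ := m₂.inv.exists_step_eq (Q := Y₃) (K := X ∪ Y₂ ∪ Y₃) (q := y₃) (u := u)
    (by grind) (by rw [h₂']; grind) (fun k hk => hE₃ k (by grind)) (by rwa [h₂'])
    (fun k hk => by rw [h₂', hu']; exact htE k (by grind))
  refine ⟨a₀, ha₀, a₁, ha₁, a₂, ha₂, a₃, ha₃, y₁, t • c₁ • y₁, y₃, rfl, e₁, ?_, e₃, ?_, ?_⟩
  · rw [← hu', ← e₂, ← cj_inv, smul_inv_smul]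
  · exact fun e he => hE₁ e (by grind)
  · exact fun e he => hE₃ e (by grind)

end StationaryIndependence

/-! ### Products of four conjugates with prescribed values -/

theorem cj_smul_finset_eq {G M : Type*} [Group G] [MulAction G M] [DecidableEq M]
    {A B : Finset M} {a : G} (ha : a ∈ fixer G B) (hA : A ⊆ B) (g : G) :
    cj a g • A = a • g • A := by
  rw [cj_smul, smul_finset_of_mem_fixer (inv_mem ha) hA]

namespace StationaryIndependence

variable {G M : Type*} [Group G] [MulAction G M] [DecidableEq M]
  {I : StationaryIndependence G M} {X : Finset M} {c₀ c₁ c₂ c₃ f : G} {Y₀ Y₁ Y₂ Y₃ Y₄ : Finset M}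

/-- A chain `Y₀ → Y₁ → Y₂ → Y₃ → Y₄` of four maximally moving automorphisms that agrees with `f` on
`Y₀` can be changed by conjugation over `X` so as to agree with `f` on `Z`, when `Z` and `f Z` are
independent from the chain at its two ends: the points of `Z` are added to `Y₀` one by one. -/
theorem exists_conj_eqOn_of_ind (Z : Finset M)
    (m₀ : I.Mover c₀) (m₁ : I.Mover c₁) (m₂ : I.Mover c₂) (m₃ : I.Mover c₃)
    (h₀ : c₀ • Y₀ = Y₁) (h₁ : c₁ • Y₁ = Y₂) (h₂ : c₂ • Y₂ = Y₃) (h₃ : c₃ • Y₃ = Y₄)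
    (hX₀ : X ⊆ Y₀) (hX₄ : X ⊆ Y₄)
    (hf : ∀ y ∈ Y₀, f • y = c₃ • c₂ • c₁ • c₀ • y)
    (hZ₀ : ∀ z ∈ Z, ∀ k ∈ Y₁, I.Ind Y₀ z k) (hZ₄ : ∀ z ∈ Z, ∀ k ∈ Y₃, I.Ind Y₄ (f • z) k) :
    ∃ a₀ ∈ fixer G X, ∃ a₁ ∈ fixer G X, ∃ a₂ ∈ fixer G X, ∃ a₃ ∈ fixer G X,
      ∀ z ∈ Y₀ ∪ Z, cj a₃ c₃ • cj a₂ c₂ • cj a₁ c₁ • cj a₀ c₀ • z = f • z := by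
  induction Z using Finset.induction_on generalizing c₀ c₁ c₂ c₃ Y₀ Y₁ Y₂ Y₃ Y₄ with
  | empty =>
    refine ⟨1, one_mem _, 1, one_mem _, 1, one_mem _, 1, one_mem _, fun z hz => ?_⟩
    simpa [cj] using (hf z (by simpa using hz)).symm
  | insert z Z _ ih =>
    obtain ⟨a₀, ha₀, a₁, ha₁, a₂, ha₂, a₃, ha₃, y₁, y₂, y₃, e₀, e₁, e₂, e₃, i₁, i₃⟩ :=
      exists_chain (X := X) m₀ m₁ m₂ m₃ h₀ h₁ h₂ h₃ hf (y₀ := z)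
        (fun k hk => by
          rcases Finset.mem_union.1 hk with hk | hk
          · exact I.of_mem ((Finset.mem_union.1 hk).elim (fun h => hX₀ h) id)
          · exact hZ₀ z (Finset.mem_insert_self _ _) k hk)
        (fun k hk => by
          by_cases hk' : k ∈ Y₄
          · exact I.of_mem hk'
          · exact hZ₄ z (Finset.mem_insert_self _ _) k (by clear ih; grind)) (Z ∪ f • Z)
    have s₀ : cj a₀ c₀ • insert z Y₀ = insert y₁ Y₁ := by
      rw [Finset.smul_finset_insert, e₀, cj_smul_finset_of_fixer ha₀ (by clear ih; grind)
        (by clear ih; grind), h₀]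
    have s₁ : cj a₁ c₁ • insert y₁ Y₁ = insert y₂ Y₂ := by
      rw [Finset.smul_finset_insert, e₁, cj_smul_finset_of_fixer ha₁ (by clear ih; grind)
        (by clear ih; grind), h₁]
    have s₂ : cj a₂ c₂ • insert y₂ Y₂ = insert y₃ Y₃ := by
      rw [Finset.smul_finset_insert, e₂, cj_smul_finset_of_fixer ha₂ (by clear ih; grind)
        (by clear ih; grind), h₂]
    have s₃ : cj a₃ c₃ • insert y₃ Y₃ = insert (f • z) Y₄ := by
      rw [Finset.smul_finset_insert, e₃, cj_smul_finset_of_fixer ha₃ (by clear ih; grind)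
        (by clear ih; grind), h₃]
    obtain ⟨b₀, hb₀, b₁, hb₁, b₂, hb₂, b₃, hb₃, hb⟩ := ih (m₀.conj a₀) (m₁.conj a₁) (m₂.conj a₂)
      (m₃.conj a₃) s₀ s₁ s₂ s₃ (by clear ih; grind)
        (by clear ih; grind)
      (fun y hy => by
        rcases Finset.mem_insert.1 hy with rfl | hy
        · rw [e₀, e₁, e₂, e₃]
        · have j₁ : c₀ • y ∈ Y₁ := h₀ ▸ Finset.smul_mem_smul_finset hy
          have j₂ : c₁ • c₀ • y ∈ Y₂ := h₁ ▸ Finset.smul_mem_smul_finset j₁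
          have j₃ : c₂ • c₁ • c₀ • y ∈ Y₃ := h₂ ▸ Finset.smul_mem_smul_finset j₂
          have j₄ : c₃ • c₂ • c₁ • c₀ • y ∈ Y₄ := h₃ ▸ Finset.smul_mem_smul_finset j₃
          rw [cj_smul_of_fixer ha₀ (by clear ih; grind)
        (by clear ih; grind), cj_smul_of_fixer ha₁ (by clear ih; grind)
        (by clear ih; grind),
            cj_smul_of_fixer ha₂ (by clear ih; grind)
        (by clear ih; grind), cj_smul_of_fixer ha₃ (by clear ih; grind)
        (by clear ih; grind)]
          exact hf y hy)
      (fun z' hz' k hk => by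
        refine I.mono (Finset.subset_insert _ _) ?_
        rcases Finset.mem_insert.1 hk with rfl | hk
        · exact I.trans (hZ₀ z' (Finset.mem_insert_of_mem hz'))
            (I.symm (i₁ z' (by clear ih; grind)))
        · exact hZ₀ z' (Finset.mem_insert_of_mem hz') k hk)
      (fun z' hz' k hk => by
        refine I.mono (Finset.subset_insert _ _) ?_
        rcases Finset.mem_insert.1 hk with rfl | hk
        · exact I.trans (hZ₄ z' (Finset.mem_insert_of_mem hz'))
            (I.symm (i₃ _ (Finset.mem_union_right _ (Finset.smul_mem_smul_finset hz'))))
        · exact hZ₄ z' (Finset.mem_insert_of_mem hz') k hk)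
    refine ⟨b₀ * a₀, mul_mem hb₀ (fixer_anti (by clear ih; grind) ha₀),
      b₁ * a₁, mul_mem hb₁ (fixer_anti (by clear ih; grind) ha₁),
      b₂ * a₂, mul_mem hb₂ (fixer_anti (by clear ih; grind) ha₂),
      b₃ * a₃, mul_mem hb₃ (fixer_anti (by clear ih; grind) ha₃), fun x hx => ?_⟩
    simp only [← cj_cj]
    exact hb x (by clear ih; grind)

/-- If the chain `Y₀ → Y₁ → Y₂ → Y₃ → Y₄` is in general position, then the product of the four
maps can be changed by conjugation over `X` to agree with any `f` on any finite set, as long as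
it agreed with `f` on `Y₀`. -/
theorem exists_conj_eqOn (Z : Finset M)
    (m₀ : I.Mover c₀) (m₁ : I.Mover c₁) (m₂ : I.Mover c₂) (m₃ : I.Mover c₃)
    (h₀ : c₀ • Y₀ = Y₁) (h₁ : c₁ • Y₁ = Y₂) (h₂ : c₂ • Y₂ = Y₃) (h₃ : c₃ • Y₃ = Y₄)
    (hX₀ : X ⊆ Y₀) (hX₄ : X ⊆ Y₄)
    (hi₁ : ∀ y ∈ Y₁, ∀ k ∈ Y₄, I.Ind Y₀ y k) (hi₃ : ∀ y ∈ Y₃, ∀ k ∈ Y₀, I.Ind Y₄ y k)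
    (hf : ∀ y ∈ Y₀, f • y = c₃ • c₂ • c₁ • c₀ • y) :
    ∃ a₀ ∈ fixer G X, ∃ a₁ ∈ fixer G X, ∃ a₂ ∈ fixer G X, ∃ a₃ ∈ fixer G X,
      ∀ z ∈ Z, cj a₃ c₃ • cj a₂ c₂ • cj a₁ c₁ • cj a₀ c₀ • z = f • z := by
  -- the inner part of the chain is moved away from `Z` and `f Z`
  obtain ⟨b, hb, hbi⟩ := I.exists_ind_finset (Y₀ ∪ Y₄) (Y₁ ∪ Y₃) (Z ∪ f • Z)
  have hbX : b ∈ fixer G X := fixer_anti (by grind) hb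
  have b₀ : b⁻¹ • Y₀ = Y₀ := smul_finset_of_mem_fixer (inv_mem hb) (by grind)
  have b₄ : b • Y₄ = Y₄ := smul_finset_of_mem_fixer hb (by grind)
  obtain ⟨a₀, ha₀, a₁, ha₁, a₂, ha₂, a₃, ha₃, ha⟩ := exists_conj_eqOn_of_ind (I := I) (X := X)
    (c₀ := cj b c₀) (c₁ := cj b c₁) (c₂ := cj b c₂) (c₃ := cj b c₃)
    (Y₀ := Y₀) (Y₁ := b • Y₁) (Y₂ := b • Y₂) (Y₃ := b • Y₃) (Y₄ := Y₄) (f := f) Z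
    (m₀.conj b) (m₁.conj b) (m₂.conj b) (m₃.conj b)
    (by rw [cj_smul, b₀, h₀]) (by rw [cj_smul, inv_smul_smul, h₁])
    (by rw [cj_smul, inv_smul_smul, h₂]) (by rw [cj_smul, inv_smul_smul, h₃, b₄]) hX₀ hX₄
    (fun y hy => by
      have j₁ : c₀ • y ∈ Y₁ := h₀ ▸ Finset.smul_mem_smul_finset hy
      have j₂ : c₁ • c₀ • y ∈ Y₂ := h₁ ▸ Finset.smul_mem_smul_finset j₁
      have j₃ : c₂ • c₁ • c₀ • y ∈ Y₃ := h₂ ▸ Finset.smul_mem_smul_finset j₂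
      have j₄ : c₃ • c₂ • c₁ • c₀ • y ∈ Y₄ := h₃ ▸ Finset.smul_mem_smul_finset j₃
      simp only [cj_smul, inv_smul_smul]
      rw [inv_smul_eq_of_mem_fixer hb (by grind), smul_eq_of_mem_fixer hb (by grind), hf y hy])
    (fun z hz k hk => by
      obtain ⟨y, hy, rfl⟩ := Finset.mem_smul_finset.1 hk
      refine I.symm (I.trans_union (B' := Y₄) (fun s hs => ?_) (hbi y (by grind) z (by grind)))
      exact I.smul_left hb (by grind) (by grind) (hi₁ y hy s hs))
    (fun z hz k hk => by
      obtain ⟨y, hy, rfl⟩ := Finset.mem_smul_finset.1 hk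
      refine I.symm (I.trans_union (B' := Y₀) (fun s hs => ?_) ?_)
      · exact I.smul_left hb (by grind) (by grind) (hi₃ y hy s hs)
      · rw [Finset.union_comm]
        exact hbi y (by grind) _ (Finset.mem_union_right _ (Finset.smul_mem_smul_finset hz)))
  refine ⟨a₀ * b, mul_mem ha₀ hbX, a₁ * b, mul_mem ha₁ hbX, a₂ * b, mul_mem ha₂ hbX,
    a₃ * b, mul_mem ha₃ hbX, fun z hz => ?_⟩
  simp only [← cj_cj]
  exact ha z (Finset.mem_union_right _ hz)

/-- Four automorphisms, the two inner ones maximally moving, can be conjugated over `X` so that they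
have a finite chain in general position that contains `X` at both ends.  Starting from the left
end, the images of `X` are called `S`, `X₂`, `X₃`, `X₄`; starting from the right end, its backward
images are called `P`, `X₂'`, `X₁'`, `X₀'`. -/
theorem exists_generalPosition (X : Finset M) (c₀ c₃ : G)
    (m₁ : I.Mover c₁) (m₂ : I.Mover c₂) :
    ∃ a₀ ∈ fixer G X, ∃ a₁ ∈ fixer G X, ∃ a₂ ∈ fixer G X, ∃ a₃ ∈ fixer G X,
      ∃ Y₀ Y₁ Y₂ Y₃ Y₄ : Finset M, cj a₀ c₀ • Y₀ = Y₁ ∧ cj a₁ c₁ • Y₁ = Y₂ ∧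
        cj a₂ c₂ • Y₂ = Y₃ ∧ cj a₃ c₃ • Y₃ = Y₄ ∧ X ⊆ Y₀ ∧ X ⊆ Y₄ ∧
        (∀ y ∈ Y₁, ∀ k ∈ Y₄, I.Ind Y₀ y k) ∧ ∀ y ∈ Y₃, ∀ k ∈ Y₀, I.Ind Y₄ y k := by
  -- the two neighbours of the ends
  obtain ⟨P, hP⟩ : ∃ P, P = c₃⁻¹ • X := ⟨_, rfl⟩
  obtain ⟨a, ha, haP⟩ := I.exists_ind_finset X (c₀ • X) P
  obtain ⟨S, hS⟩ : ∃ S, S = cj a c₀ • X := ⟨_, rfl⟩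
  have hSP : ∀ s ∈ S, ∀ p ∈ P, I.Ind X s p := by
    intro s hs p hp
    rw [hS, cj_smul_finset_eq ha subset_rfl] at hs
    obtain ⟨x, hx, rfl⟩ := Finset.mem_smul_finset.1 hs
    exact haP x hx p hp
  -- the second map is put in general position, as far as `X` and `S` go
  obtain ⟨b, hb, hbP⟩ := I.exists_ind_finset (X ∪ S) (c₁ • X ∪ c₁⁻¹ • X ∪ c₁ • S) P
  obtain ⟨T₁, hT₁⟩ : ∃ T, T = cj b c₁ • X ∪ cj b c₁⁻¹ • X ∪ cj b c₁ • S := ⟨_, rfl⟩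
  have hTP : ∀ t ∈ T₁, ∀ p ∈ P, I.Ind X t p := by
    intro t ht p hp
    rw [hT₁, cj_smul_finset_eq hb (by grind), cj_smul_finset_eq hb (by grind),
      cj_smul_finset_eq hb (by grind), ← Finset.smul_finset_union, ← Finset.smul_finset_union] at ht
    obtain ⟨t, ht', rfl⟩ := Finset.mem_smul_finset.1 ht
    exact I.symm (I.trans_union (fun s hs => I.symm (hSP s hs p hp)) (I.symm (hbP t ht' p hp)))
  obtain ⟨X₂, hX₂⟩ : ∃ X₂, X₂ = cj b c₁ • S := ⟨_, rfl⟩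
  -- the third map
  obtain ⟨E, hE⟩ : ∃ E, E = X ∪ S ∪ P ∪ T₁ := ⟨_, rfl⟩
  obtain ⟨d, hd, hdE⟩ := I.exists_ind_finset X (c₂ • X ∪ c₂⁻¹ • X) E
  obtain ⟨T₂, hT₂⟩ : ∃ T, T = cj d c₂ • X ∪ cj d c₂⁻¹ • X := ⟨_, rfl⟩
  have hTE : ∀ t ∈ T₂, ∀ e ∈ E, I.Ind X t e := by
    intro t ht p hp
    rw [hT₂, cj_smul_finset_eq hd subset_rfl, cj_smul_finset_eq hd subset_rfl,
      ← Finset.smul_finset_union] at ht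
    obtain ⟨t, ht', rfl⟩ := Finset.mem_smul_finset.1 ht
    exact hdE t ht' p hp
  obtain ⟨d', hd', hdE'⟩ := (m₂.conj d).exists_step_finset (X := X) (K := X ∪ T₂) (Q := X₂)
    (by grind) (by grind) (fun q hq k hk => by
      rcases Finset.mem_union.1 hk with hk | hk
      · exact I.of_mem hk
      · exact I.symm (hTE k hk q (by grind))) E
  obtain ⟨X₃, hX₃⟩ : ∃ X₃, X₃ = cj d' (cj d c₂) • X₂ := ⟨_, rfl⟩
  have h3E : ∀ x ∈ X₃, ∀ e ∈ E, I.Ind X x e := by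
    intro x hx e he
    obtain ⟨q, hq, rfl⟩ := Finset.mem_smul_finset.1 (hX₃ ▸ hx)
    exact I.trans_left (fun b hb => hTE b (by grind) e he) (hdE' q hq e he)
  have hinv : cj d' (cj d c₂⁻¹) • X = cj d c₂⁻¹ • X :=
    cj_smul_finset_of_fixer hd' (by grind) (by grind)
  obtain ⟨d'', hd'', hdE''⟩ := ((m₂.conj d).conj d').inv.exists_step_finset (X := X)
    (K := X ∪ T₂ ∪ X₂ ∪ X₃) (Q := P) (by grind) (by rw [cj_inv, cj_inv, hinv]; grind)
    (fun q hq k hk => by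
      by_cases hk₀ : k ∈ X
      · exact I.of_mem hk₀
      by_cases hk₁ : k ∈ T₂
      · exact I.symm (hTE k hk₁ q (by grind))
      by_cases hk₂ : k ∈ X₂
      · exact I.symm (hTP k (by grind) q hq)
      · exact I.symm (h3E k (by grind) q (by grind))) E
  rw [cj_inv, cj_inv, hinv] at hdE''
  obtain ⟨X₂', hX₂'⟩ : ∃ X₂', X₂' = cj d'' (cj d' (cj d c₂⁻¹)) • P := ⟨_, rfl⟩
  have h2E : ∀ x ∈ X₂', ∀ e ∈ E, I.Ind X x e := by
    intro x hx e he
    obtain ⟨q, hq, rfl⟩ := Finset.mem_smul_finset.1 (hX₂' ▸ hx)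
    exact I.trans_left (fun b hb => hTE b (by grind) e he) (hdE'' q hq e he)
  -- the second map again, backwards from `X₂'`
  obtain ⟨b', hb', hbE'⟩ := (m₁.conj b).inv.exists_step_finset (X := X) (K := X ∪ T₁ ∪ S)
    (Q := X₂') (by grind) (by rw [cj_inv]; grind) (fun q hq k hk => h2E q hq k (by grind)) (P ∪ X₃)
  rw [cj_inv] at hbE'
  obtain ⟨X₁', hX₁'⟩ : ∃ X₁', X₁' = cj b' (cj b c₁⁻¹) • X₂' := ⟨_, rfl⟩
  have h1E : ∀ x ∈ X₁', ∀ e ∈ P ∪ X₃, I.Ind X x e := by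
    intro x hx e he
    obtain ⟨q, hq, rfl⟩ := Finset.mem_smul_finset.1 (hX₁' ▸ hx)
    refine I.trans_left (fun b hb => ?_) (hbE' q hq e he)
    rcases Finset.mem_union.1 he with he | he
    · exact hTP b (by grind) e he
    · exact I.symm (h3E e he b (by grind))
  -- the key independence of the two sides
  have key : ∀ p ∈ P ∪ X₃, ∀ s ∈ S ∪ X₁', I.Ind X p s := by
    intro p hp s hs
    rcases Finset.mem_union.1 hs with hs | hs
    · rcases Finset.mem_union.1 hp with hp | hp
      · exact I.symm (hSP s hs p hp)
      · exact h3E p hp s (by grind)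
    · exact I.symm (h1E s hs p hp)
  -- the outer maps
  obtain ⟨a', ha', haE'⟩ := I.exists_ind_finset (X ∪ (S ∪ X₁')) (cj a c₀⁻¹ • X₁') (P ∪ X₃)
  obtain ⟨X₀', hX₀'⟩ : ∃ X₀', X₀' = cj a' (cj a c₀⁻¹) • X₁' := ⟨_, rfl⟩
  have h0E : ∀ p ∈ P ∪ X₃, ∀ x ∈ X₀', I.Ind X p x := by
    intro p hp x hx
    rw [hX₀', cj_smul_finset_eq ha' (by grind)] at hx
    obtain ⟨q, hq, rfl⟩ := Finset.mem_smul_finset.1 hx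
    exact I.trans_union (key p hp) (I.symm (haE' q hq p hp))
  obtain ⟨u, hu, huE⟩ := I.exists_ind_finset (X ∪ (P ∪ X₃)) (c₃ • X₃) (S ∪ X₁')
  obtain ⟨X₄, hX₄⟩ : ∃ X₄, X₄ = cj u c₃ • X₃ := ⟨_, rfl⟩
  have hci : ∀ {a g : G} {A B : Finset M}, B = cj a g⁻¹ • A → cj a g • B = A := by
    rintro a g A _ rfl
    rw [← cj_inv, smul_inv_smul]
  refine ⟨a' * a, mul_mem (fixer_anti (by grind) ha') ha,
    b' * b, mul_mem (fixer_anti (by grind) hb') (fixer_anti (by grind) hb),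
    d'' * d' * d, mul_mem (mul_mem (fixer_anti (by grind) hd'') (fixer_anti (by grind) hd')) hd,
    u, fixer_anti (by grind) hu, X ∪ X₀', S ∪ X₁', X₂ ∪ X₂', X₃ ∪ P, X₄ ∪ X,
    ?_, ?_, ?_, ?_, Finset.subset_union_left, Finset.subset_union_right, ?_, ?_⟩
  · rw [Finset.smul_finset_union]
    congr 1
    · rw [← cj_cj, cj_smul_finset_of_fixer ha' (by grind) (by grind), hS]
    · exact hci (by rw [hX₀', cj_cj])
  · rw [Finset.smul_finset_union]
    congr 1
    · rw [← cj_cj, cj_smul_finset_of_fixer hb' (by grind) (by grind), hX₂]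
    · exact hci (by rw [hX₁', cj_cj])
  · rw [Finset.smul_finset_union]
    congr 1
    · rw [mul_assoc, ← cj_cj, ← cj_cj, cj_smul_finset_of_fixer hd'' (by grind) (by grind), hX₃]
    · exact hci (by rw [hX₂', cj_cj, cj_cj, mul_assoc])
  · rw [Finset.smul_finset_union]
    congr 1
    · exact hX₄.symm
    · exact hci (by rw [cj_smul_finset_eq hu (by grind), ← hP,
        smul_finset_of_mem_fixer hu (by grind)])
  · intro y hy k hk
    rcases Finset.mem_union.1 hk with hk | hk
    · rw [hX₄, cj_smul_finset_eq hu (by grind)] at hk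
      obtain ⟨q, hq, rfl⟩ := Finset.mem_smul_finset.1 hk
      refine I.trans (B' := X ∪ (P ∪ X₃)) (fun p hp => ?_) (I.symm (huE q hq y hy))
      rcases Finset.mem_union.1 hp with hp | hp
      · exact I.of_mem (Finset.mem_union_left _ hp)
      · refine I.symm (I.mono Finset.subset_union_left (key p hp y hy))
    · exact I.of_mem (Finset.mem_union_left _ hk)
  · intro y hy k hk
    refine I.mono Finset.subset_union_right ?_
    rcases Finset.mem_union.1 hk with hk | hk
    · exact I.of_mem hk
    · exact h0E y (by grind) k hk

end StationaryIndependence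

/-! ### Limits of sequences of automorphisms -/

section Limits

variable (G M : Type*) [Group G] [MulAction G M]

/-- `G` is closed as a group of permutations of `M`: pointwise limits of sequences in `G` whose
inverses converge as well belong to `G`. -/
def IsClosedAction : Prop :=
  ∀ h : ℕ → G, (∀ m : M, ∃ N, ∀ t ≥ N, h t • m = h N • m) →
    (∀ m : M, ∃ N, ∀ t ≥ N, (h t)⁻¹ • m = (h N)⁻¹ • m) → ∃ g : G, ∀ m : M, ∃ N, ∀ t ≥ N,
      h t • m = g • m

variable {G M}

/-- A sequence in which each term arises from the previous one by multiplication on the left with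
an element that fixes `X t` has a limit in a closed group, provided the sets `X t` exhaust `M` both
on the side of the images and on the side of the arguments. -/
theorem IsClosedAction.exists_limit (hG : IsClosedAction G M) {h : ℕ → G} {X : ℕ → Finset M}
    (hX : Monotone X) (hstep : ∀ t, h (t + 1) * (h t)⁻¹ ∈ fixer G (X t))
    (hcov : ∀ m, ∃ t, m ∈ X t) (hcov' : ∀ m, ∃ t, h t • m ∈ X t) :
    ∃ g : G, ∀ t, g * (h t)⁻¹ ∈ fixer G (X t) := by
  have key : ∀ t s, t ≤ s → h s * (h t)⁻¹ ∈ fixer G (X t) := by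
    intro t s hts
    induction s, hts using Nat.le_induction with
    | base => simp
    | succ s hts ih =>
      have := mul_mem (fixer_anti (hX hts) (hstep s)) ih
      simpa [mul_assoc] using this
  obtain ⟨g, hg⟩ := hG h
    (fun m => by
      obtain ⟨t, ht⟩ := hcov' m
      refine ⟨t, fun s hs => ?_⟩
      have := smul_eq_of_mem_fixer (key t s hs) ht
      simpa [mul_smul] using this)
    (fun m => by
      obtain ⟨t, ht⟩ := hcov m
      refine ⟨t, fun s hs => ?_⟩
      have := inv_smul_eq_of_mem_fixer (key t s hs) ht
      rw [mul_inv_rev, inv_inv, mul_smul] at this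
      rw [eq_inv_smul_iff, this])
  refine ⟨g, fun t => mem_fixer.2 fun x hx => ?_⟩
  obtain ⟨N, hN⟩ := hg ((h t)⁻¹ • x)
  rw [mul_smul, ← hN (max N t) (le_max_left _ _), ← mul_smul]
  exact smul_eq_of_mem_fixer (key t _ (le_max_right _ _)) hx

/-- The family `h'` arises from `h` by multiplication on the left with elements that fix `X`
pointwise. -/
def Near {ι : Type*} (X : Finset M) (h h' : ι → G) : Prop :=
  ∀ i, h' i * (h i)⁻¹ ∈ fixer G X

variable {ι : Type*} {X X' : Finset M} {h h' h'' : ι → G}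

theorem Near.refl (X : Finset M) (h : ι → G) : Near X h h := fun i => by simp

theorem Near.symm (H : Near X h h') : Near X h' h := fun i => by
  simpa using inv_mem (H i)

theorem Near.trans (H : Near X h h') (H' : Near X h' h'') : Near X h h'' := fun i => by
  simpa [mul_assoc] using mul_mem (H' i) (H i)

theorem Near.anti (hX : X ⊆ X') (H : Near X' h h') : Near X h h' := fun i =>
  fixer_anti hX (H i)

theorem Near.smul_eq (H : Near X h h') {i : ι} {m : M} (hm : h i • m ∈ X) :
    h' i • m = h i • m := by
  simpa [mul_smul] using smul_eq_of_mem_fixer (H i) hm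

theorem IsClosedAction.exists_limit_near (hG : IsClosedAction G M) {h : ℕ → ι → G}
    {X : ℕ → Finset M} (hX : Monotone X) (hstep : ∀ t, Near (X t) (h t) (h (t + 1)))
    (hcov : ∀ m, ∃ t, m ∈ X t) (hcov' : ∀ m, ∃ t, ∀ i, h t i • m ∈ X t) :
    ∃ g : ι → G, ∀ t, Near (X t) (h t) g := by
  choose g hg using fun i => hG.exists_limit (h := fun t => h t i) hX (fun t => hstep t i) hcov
    (fun m => (hcov' m).imp fun t ht => ht i)
  exact ⟨g, fun t i => hg i t⟩

theorem exists_subset_of_cover {X : ℕ → Finset M} (hX : Monotone X)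
    (hcov : ∀ m, ∃ t, m ∈ X t) (T : Finset M) : ∃ t, T ⊆ X t := by
  classical
  induction T using Finset.induction_on with
  | empty => exact ⟨0, by simp⟩
  | insert m T _ ih =>
    obtain ⟨t, ht⟩ := ih
    obtain ⟨s, hs⟩ := hcov m
    exact ⟨max s t, Finset.insert_subset (hX (le_max_left _ _) hs)
      (ht.trans (hX (le_max_right _ _)))⟩

end Limits

section ProdConj

variable {G M : Type*} [Group G] [MulAction G M]

/-- The product of the four conjugates of `g` by `h 0`, …, `h 3`. -/
def prodConj (g : G) (h : Fin 4 → G) : G :=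
  cj (h 3) g * cj (h 2) g * cj (h 1) g * cj (h 0) g

theorem prodConj_smul (g : G) (h : Fin 4 → G) (x : M) :
    prodConj g h • x = cj (h 3) g • cj (h 2) g • cj (h 1) g • cj (h 0) g • x := by
  simp [prodConj, mul_smul]

theorem prodConj_mem {N : Subgroup G} [hN : N.Normal] {g : G} (hg : g ∈ N) (h : Fin 4 → G) :
    prodConj g h ∈ N :=
  mul_mem (mul_mem (mul_mem (hN.conj_mem g hg _) (hN.conj_mem g hg _)) (hN.conj_mem g hg _))
    (hN.conj_mem g hg _)

variable [DecidableEq M]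

/-- Products of four conjugates depend continuously on the conjugating elements. -/
theorem exists_finset_prodConj_eq (g : G) (h : Fin 4 → G) (Z : Finset M) :
    ∃ T : Finset M, ∀ h', Near T h h' → ∀ z ∈ Z, prodConj g h' • z = prodConj g h • z := by
  refine ⟨Z ∪ cj (h 0) g • Z ∪ cj (h 1) g • cj (h 0) g • Z
    ∪ cj (h 2) g • cj (h 1) g • cj (h 0) g • Z
    ∪ cj (h 3) g • cj (h 2) g • cj (h 1) g • cj (h 0) g • Z, fun h' H z hz => ?_⟩
  have e : ∀ i, cj (h' i) g = cj (h' i * (h i)⁻¹) (cj (h i) g) := fun i => by simp [cj_cj]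
  have i₁ := Finset.smul_mem_smul_finset (a := cj (h 0) g) hz
  have i₂ := Finset.smul_mem_smul_finset (a := cj (h 1) g) i₁
  have i₃ := Finset.smul_mem_smul_finset (a := cj (h 2) g) i₂
  have i₄ := Finset.smul_mem_smul_finset (a := cj (h 3) g) i₃
  rw [prodConj_smul, prodConj_smul, e 0, e 1, e 2, e 3,
    cj_smul_of_fixer (H 0) (by simp [hz]) (by simp only [Finset.mem_union]; tauto),
    cj_smul_of_fixer (H 1) (by simp only [Finset.mem_union]; tauto)
      (by simp only [Finset.mem_union]; tauto),
    cj_smul_of_fixer (H 2) (by simp only [Finset.mem_union]; tauto)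
      (by simp only [Finset.mem_union]; tauto),
    cj_smul_of_fixer (H 3) (by simp only [Finset.mem_union]; tauto)
      (by simp only [Finset.mem_union]; tauto)]

theorem exists_prodConj_eq_of_limit {g : G} {X : ℕ → Finset M} (hX : Monotone X)
    (hcov : ∀ m, ∃ t, m ∈ X t) {h : ℕ → Fin 4 → G} {h' : Fin 4 → G}
    (hh : ∀ t, Near (X t) (h t) h') (z : M) :
    ∃ N, ∀ t ≥ N, prodConj g (h t) • z = prodConj g h' • z := by
  obtain ⟨T, hT⟩ := exists_finset_prodConj_eq g h' {z}
  obtain ⟨N, hN⟩ := exists_subset_of_cover hX hcov T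
  exact ⟨N, fun t ht => hT _ ((hh t).symm.anti (hN.trans (hX ht))) z (Finset.mem_singleton_self z)⟩

end ProdConj

namespace StationaryIndependence

variable {G M : Type*} [Group G] [MulAction G M] [DecidableEq M]
  {I : StationaryIndependence G M}

/-! ### Normal subgroups containing a maximally moving element are open -/

/-- The product of the conjugates of `g` by `h` can be changed, by changing `h` over `X` only, to
agree on any finite set with any given element that agrees with it on `Z`. -/
def Flexible (g : G) (X : Finset M) (h : Fin 4 → G) (Z : Finset M) : Prop :=
  ∀ f : G, (∀ z ∈ Z, f • z = prodConj g h • z) → ∀ Z' : Finset M,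
    ∃ h', Near X h h' ∧ ∀ z ∈ Z', prodConj g h' • z = f • z

/-- Conjugates of a maximally moving element can be made flexible, with a set `Z` that contains a
given finite set. -/
theorem Mover.exists_flexible {g : G} (hg : I.Mover g) (X : Finset M) (h : Fin 4 → G)
    (W : Finset M) : ∃ h', Near X h h' ∧ ∃ Z, W ⊆ Z ∧ Flexible g X h' Z := by
  obtain ⟨a₀, ha₀, a₁, ha₁, a₂, ha₂, a₃, ha₃, Y₀, Y₁, Y₂, Y₃, Y₄, h₀, h₁, h₂, h₃, hX₀, hX₄, i₁,
      i₃⟩ :=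
    exists_generalPosition (I := I) X (cj (h 0) g) (cj (h 3) g) (hg.conj (h 1)) (hg.conj (h 2))
  refine ⟨![a₀ * h 0, a₁ * h 1, a₂ * h 2, a₃ * h 3], fun i => ?_, Y₀ ∪ W,
    Finset.subset_union_right, fun f hf Z' => ?_⟩
  · fin_cases i <;> simpa using ‹_›
  obtain ⟨b₀, hb₀, b₁, hb₁, b₂, hb₂, b₃, hb₃, hb⟩ := exists_conj_eqOn (f := f) Z'
    ((hg.conj _).conj a₀) ((hg.conj _).conj a₁) ((hg.conj _).conj a₂) ((hg.conj _).conj a₃)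
    h₀ h₁ h₂ h₃ hX₀ hX₄ i₁ i₃
    (fun y hy => by
      have := hf y (Finset.mem_union_left _ hy)
      rw [this, prodConj_smul]
      simp [cj_cj])
  refine ⟨![b₀ * a₀ * h 0, b₁ * a₁ * h 1, b₂ * a₂ * h 2, b₃ * a₃ * h 3], fun i => ?_,
    fun z hz => ?_⟩
  · fin_cases i <;> simpa [mul_assoc] using ‹_›
  · rw [← hb z hz, prodConj_smul]
    simp [cj_cj, mul_assoc]

/-- A position in the game that represents `F` as a quotient of two products of four conjugates of
`g`: the conjugators `u` and `v` chosen so far, the finite sets `X` and `T` over which they will be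
changed from now on, and the finite set `Z` where the required equation has been achieved. -/
structure GamePosition (F g : G) (M : Type*) [MulAction G M] [DecidableEq M] where
  /-- conjugators of the first product -/
  u : Fin 4 → G
  /-- conjugators of the second product -/
  v : Fin 4 → G
  /-- `u` will be changed over `X` -/
  X : Finset M
  /-- `v` will be changed over `T` -/
  T : Finset M
  /-- the equation holds on `Z` -/
  Z : Finset M
  eqOn : ∀ z ∈ Z, F • prodConj g u • z = prodConj g v • z
  flexible : Flexible g X u Z

/-- A move in the game: after it, the equation holds at `m`, and the later changes affect neither
the values of the conjugators at `m` nor those of their inverses. -/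
theorem Mover.exists_next {F g : G} (hg : I.Mover g) (S : GamePosition F g M) (m : M) :
    ∃ S' : GamePosition F g M, Near S.X S.u S'.u ∧ Near S.T S.v S'.v ∧ S.X ⊆ S'.X ∧ S.T ⊆ S'.T ∧
      S.Z ⊆ S'.Z ∧ m ∈ S'.X ∧ m ∈ S'.T ∧ m ∈ S'.Z ∧ (∀ i, S'.u i • m ∈ S'.X) ∧
      ∀ i, S'.v i • m ∈ S'.T := by
  -- `v` is made flexible, and `u` follows
  obtain ⟨T₀, hT₀⟩ := exists_finset_prodConj_eq g S.v S.Z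
  let T := S.T ∪ T₀ ∪ {m} ∪ Finset.univ.image fun i => S.v i • m
  obtain ⟨v', hv', Z', hZ', hfv⟩ := hg.exists_flexible T S.v (insert m S.Z)
  have hv'Z : ∀ z ∈ S.Z, prodConj g v' • z = prodConj g S.v • z :=
    hT₀ v' (hv'.anti (by simp only [T]; grind))
  obtain ⟨u', hu', hu'Z⟩ := S.flexible (F⁻¹ * prodConj g v')
    (fun z hz => by rw [mul_smul, hv'Z z hz, ← S.eqOn z hz, inv_smul_smul]) Z'
  -- `u` is made flexible, and `v` follows
  obtain ⟨X₀, hX₀⟩ := exists_finset_prodConj_eq g u' Z'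
  let X := S.X ∪ X₀ ∪ {m} ∪ Finset.univ.image fun i => u' i • m
  obtain ⟨u'', hu'', Z'', hZ'', hfu⟩ := hg.exists_flexible X u' Z'
  have hu''Z : ∀ z ∈ Z', prodConj g u'' • z = prodConj g u' • z :=
    hX₀ u'' (hu''.anti (by simp only [X]; grind))
  obtain ⟨v'', hv'', hv''Z⟩ := hfv (F * prodConj g u'')
    (fun z hz => by rw [mul_smul, hu''Z z hz, hu'Z z hz, mul_smul, smul_inv_smul]) Z''
  have hXX : S.X ⊆ X := by simp only [X]; grind
  have hTT : S.T ⊆ T := by simp only [T]; grind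
  refine ⟨⟨u'', v'', X, T, Z'', fun z hz => ?_, hfu⟩, hu'.trans (hu''.anti hXX),
    (hv'.trans hv'').anti hTT, hXX, hTT, ((Finset.subset_insert _ _).trans hZ').trans hZ'', ?_, ?_,
    hZ'' (hZ' (Finset.mem_insert_self _ _)), fun i => ?_, fun i => ?_⟩
  · rw [hv''Z z hz, mul_smul]
  · simp [X]
  · simp [T]
  · have : u' i • m ∈ X := by simp [X]
    rwa [hu''.smul_eq this]
  · have : S.v i • m ∈ T := by simp [T]
    rwa [(hv'.trans hv'').smul_eq this]

/-- All elements of the pointwise stabiliser of some finite set are quotients of two products of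
four conjugates of a maximally moving element: the conjugators are limits of the positions in an
infinite game. -/
theorem Mover.exists_prodConj_eq [Countable M] (hG : IsClosedAction G M) {g : G} (hg : I.Mover g) :
    ∃ Y : Finset M, ∀ F ∈ fixer G Y, ∃ u v : Fin 4 → G, ∀ z : M,
      F • prodConj g u • z = prodConj g v • z := by
  obtain ⟨h, -, Z, -, hZ⟩ := hg.exists_flexible ∅ 1 ∅
  refine ⟨prodConj g h • Z, fun F hF => ?_⟩
  rcases isEmpty_or_nonempty M with hM | hM
  · exact ⟨1, 1, fun z => isEmptyElim z⟩
  obtain ⟨e, he⟩ := exists_surjective_nat M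
  let S₀ : GamePosition F g M := ⟨h, h, ∅, ∅, Z, fun z hz =>
    smul_eq_of_mem_fixer hF (Finset.smul_mem_smul_finset hz), hZ⟩
  choose next h₁ h₂ h₃ h₄ h₅ h₆ h₇ h₈ h₉ h₁₀ using hg.exists_next (F := F)
  let S : ℕ → GamePosition F g M := fun t => Nat.rec S₀ (fun t s => next s (e t)) t
  have hS : ∀ t, S (t + 1) = next (S t) (e t) := fun t => rfl
  have mX : Monotone fun t => (S t).X := monotone_nat_of_le_succ fun t => h₃ _ _
  have mT : Monotone fun t => (S t).T := monotone_nat_of_le_succ fun t => h₄ _ _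
  have mZ : Monotone fun t => (S t).Z := monotone_nat_of_le_succ fun t => h₅ _ _
  have cX : ∀ m, ∃ t, m ∈ (S t).X := fun m => by
    obtain ⟨t, rfl⟩ := he m
    exact ⟨t + 1, h₆ _ _⟩
  have cT : ∀ m, ∃ t, m ∈ (S t).T := fun m => by
    obtain ⟨t, rfl⟩ := he m
    exact ⟨t + 1, h₇ _ _⟩
  obtain ⟨u, hu⟩ := hG.exists_limit_near (h := fun t => (S t).u) mX (fun t => h₁ _ _) cX
    (fun m => by
      obtain ⟨t, rfl⟩ := he m
      exact ⟨t + 1, h₉ _ _⟩)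
  obtain ⟨v, hv⟩ := hG.exists_limit_near (h := fun t => (S t).v) mT (fun t => h₂ _ _) cT
    (fun m => by
      obtain ⟨t, rfl⟩ := he m
      exact ⟨t + 1, h₁₀ _ _⟩)
  refine ⟨u, v, fun z => ?_⟩
  obtain ⟨N₁, hN₁⟩ := exists_prodConj_eq_of_limit (g := g) mX cX hu z
  obtain ⟨N₂, hN₂⟩ := exists_prodConj_eq_of_limit (g := g) mT cT hv z
  obtain ⟨t, rfl⟩ := he z
  have hz : e t ∈ (S (max (t + 1) (max N₁ N₂))).Z := mZ (le_max_left _ _) (h₈ _ _)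
  rw [← hN₁ (max (t + 1) (max N₁ N₂)) (by simp), ← hN₂ (max (t + 1) (max N₁ N₂)) (by simp)]
  exact (S _).eqOn _ hz

/-- A normal subgroup that contains the pointwise stabiliser of a finite set is the whole group. -/
theorem eq_top_of_fixer_le (I : StationaryIndependence G M) (N : Subgroup G) [hN : N.Normal]
    {Y : Finset M} (hY : fixer G Y ≤ N) : N = ⊤ := by
  rw [eq_top_iff]
  intro f _
  -- the stabiliser of a generic copy `h Y` of `Y` contains an element that agrees with `f` on `Y`
  obtain ⟨h, -, hh⟩ := I.exists_ind_finset ∅ Y (Y ∪ f • Y)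
  have hhN : fixer G (h • Y) ≤ N := by
    intro a ha
    have : h⁻¹ * a * h⁻¹⁻¹ ∈ N := hY <| mem_fixer.2 fun y hy => by
      rw [inv_inv, mul_smul, mul_smul, smul_eq_of_mem_fixer ha (Finset.smul_mem_smul_finset hy),
        inv_smul_smul]
    have := hN.conj_mem _ this h
    simpa [mul_assoc] using this
  have key : ∀ T ⊆ Y, ∃ k ∈ fixer G (h • Y), ∀ y ∈ T, k • y = f • y := by
    intro T
    induction T using Finset.induction_on with
    | empty => exact fun _ => ⟨1, one_mem _, by simp⟩
    | insert y T _ ih =>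
      intro hT
      obtain ⟨hyY, hTY⟩ := Finset.insert_subset_iff.1 hT
      obtain ⟨k, hk, hkT⟩ := ih hTY
      obtain ⟨a, ha, hay⟩ := I.stationary (B := f • T) (D := h • Y) (x := k • y) (h := f * k⁻¹)
        (mem_fixer.2 fun b hb => by
          obtain ⟨b, hb', rfl⟩ := Finset.mem_smul_finset.1 hb
          have : k⁻¹ • f • b = b := by rw [← hkT b hb', inv_smul_smul]
          rw [mul_smul, this])
        (fun d hd => by
          obtain ⟨d, hd', rfl⟩ := Finset.mem_smul_finset.1 hd
          have := I.smul_fixer hk (by simp) (hh d hd' y (Finset.mem_union_left _ hyY))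
          rw [smul_eq_of_mem_fixer hk hd] at this
          exact I.mono (by simp) (I.symm this))
        (fun d hd => by
          obtain ⟨d, hd', rfl⟩ := Finset.mem_smul_finset.1 hd
          rw [mul_smul, inv_smul_smul]
          exact I.mono (by simp) (I.symm (hh d hd' (f • y)
            (Finset.mem_union_right _ (Finset.smul_mem_smul_finset hyY)))))
      rw [mul_smul, inv_smul_smul] at hay
      refine ⟨a * k, mul_mem (fixer_anti Finset.subset_union_right ha) hk, fun z hz => ?_⟩
      rcases Finset.mem_insert.1 hz with rfl | hz
      · rw [mul_smul, hay]
      · rw [mul_smul, hkT z hz, smul_eq_of_mem_fixer ha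
          (Finset.mem_union_left _ (Finset.smul_mem_smul_finset hz))]
  obtain ⟨k, hk, hkY⟩ := key Y subset_rfl
  have : k⁻¹ * f ∈ N := hY <| mem_fixer.2 fun y hy => by
    rw [mul_smul, ← hkY y hy, inv_smul_smul]
  simpa using mul_mem (hhN hk) this

/-! ### From automorphisms that move all types to maximally moving ones -/

/-- Every type over a finite set that is not realised in the set has a realisation moved by `g`. -/
def MovesTypes (g : G) (M : Type*) [MulAction G M] : Prop :=
  ∀ (X : Finset M) (y : M), y ∉ X → ∃ s ∈ fixer G X, g • s • y ≠ s • y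

theorem MovesTypes.conj {g : G} (hg : MovesTypes g M) (a : G) : MovesTypes (cj a g) M := by
  intro X y hy
  obtain ⟨s, hs, hne⟩ := hg (a⁻¹ • X) (a⁻¹ • y) (by rwa [Finset.smul_mem_smul_finset_iff])
  refine ⟨cj a s, mem_fixer.2 fun x hx => ?_, ?_⟩
  · rw [cj_smul, smul_eq_of_mem_fixer hs (Finset.smul_mem_smul_finset hx), smul_inv_smul]
  · rw [cj_smul, cj_smul, inv_smul_smul, ne_eq, smul_left_cancel_iff]
    exact hne

/-- One step of a random walk: `c` is conjugated over `K` so that it takes `z` to a new point that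
is as independent as possible from given points. -/
theorem MovesTypes.exists_step {c : G} (hc : MovesTypes c M) (I : StationaryIndependence G M)
    {X K : Finset M} {z : M} (hX : X ⊆ K) (hcX : c • X ⊆ K) (hz : z ∉ K)
    (hi : ∀ k ∈ K, I.Ind X z k) (e : M) :
    ∃ a ∈ fixer G K, cj a c • z ∉ insert z K ∧ (∀ k ∈ K, I.Ind (c • X) (cj a c • z) k) ∧
      I.Ind (insert z K) (cj a c • z) e := by
  obtain ⟨s₁, hs₁, hw⟩ := I.exists_ind K (K ∪ c⁻¹ • K) z
  have hwK : s₁ • z ∉ K ∪ c⁻¹ • K := fun h => hz <| by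
    have := I.mem_of_self (hw _ h)
    rwa [← smul_finset_of_mem_fixer hs₁ subset_rfl, Finset.smul_mem_smul_finset_iff] at this
  obtain ⟨s₂, hs₂, hne⟩ := hc _ _ hwK
  have hs₂K : s₂ ∈ fixer G K := fixer_anti Finset.subset_union_left hs₂
  have hv : ∀ d ∈ K ∪ c⁻¹ • K, I.Ind X (s₂ • s₁ • z) d := by
    intro d hd
    refine I.smul_left hs₂ (hX.trans Finset.subset_union_left) hd ?_
    exact I.trans (fun k hk => I.smul_left hs₁ hX hk (hi k hk)) (hw d hd)
  have hvK : s₂ • s₁ • z ∉ c⁻¹ • K := fun h => by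
    rw [← smul_finset_of_mem_fixer hs₂ Finset.subset_union_right,
      Finset.smul_mem_smul_finset_iff] at h
    exact hwK (Finset.mem_union_right _ h)
  have hcv : c • s₂ • s₁ • z ∉ K := fun h => hvK (by
    rw [← Finset.smul_mem_smul_finset_iff c, smul_inv_smul]; exact h)
  have hcvi : ∀ k ∈ K, I.Ind (c • X) (c • s₂ • s₁ • z) k := by
    intro k hk
    have := I.smul c (hv (c⁻¹ • k) (Finset.mem_union_right _ (Finset.smul_mem_smul_finset hk)))
    rwa [smul_inv_smul] at this
  have hr : (s₂ * s₁)⁻¹ ∈ fixer G K := inv_mem (mul_mem hs₂K hs₁)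
  obtain ⟨t, ht, hte⟩ := I.exists_ind (insert z K) {e} ((s₂ * s₁)⁻¹ • c • s₂ • s₁ • z)
  have htK : t ∈ fixer G K := fixer_anti (Finset.subset_insert _ _) ht
  have key : cj (t * (s₂ * s₁)⁻¹) c • z = t • (s₂ * s₁)⁻¹ • c • s₂ • s₁ • z := by
    simp only [cj, mul_smul, mul_inv_rev, inv_inv]
    rw [inv_smul_eq_of_mem_fixer ht (Finset.mem_insert_self _ _)]
  refine ⟨t * (s₂ * s₁)⁻¹, mul_mem htK hr, ?_, ?_, ?_⟩
  · rw [key, ← smul_finset_of_mem_fixer ht subset_rfl, Finset.smul_mem_smul_finset_iff,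
      Finset.mem_insert, not_or]
    refine ⟨fun h => hne ?_, fun h => hcv ?_⟩
    · rw [inv_smul_eq_iff, mul_smul] at h
      exact h
    · rwa [← smul_finset_of_mem_fixer hr subset_rfl, Finset.smul_mem_smul_finset_iff] at h
  · intro k hk
    rw [key]
    exact I.smul_left htK hcX hk (I.smul_left hr hcX hk (hcvi k hk))
  · rw [key]
    exact hte e (Finset.mem_singleton_self e)

/-- Four conjugates of an automorphism that moves all types can be conjugated over `K` so that
their product moves maximally a given type. -/
theorem MovesTypes.exists_moverAt {g : G} (hg : MovesTypes g M) (I : StationaryIndependence G M)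
    (h : Fin 4 → G) (K X : Finset M) (y : M) :
    ∃ h', Near K h h' ∧ I.MoverAt (prodConj g h') X y := by
  by_cases hy : y ∈ X
  · refine ⟨h, Near.refl _ _, 1, one_mem _, ?_⟩
    rw [one_smul]
    have := Finset.smul_mem_smul_finset (a := prodConj g h) hy
    exact ⟨⟨I.of_mem_left this, fun _ _ => I.of_mem_left this⟩,
      I.of_mem_left hy, fun _ _ => I.of_mem_left hy⟩
  obtain ⟨c₀, hc₀⟩ : ∃ c, c = cj (h 0) g := ⟨_, rfl⟩
  obtain ⟨c₁, hc₁⟩ : ∃ c, c = cj (h 1) g := ⟨_, rfl⟩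
  obtain ⟨c₂, hc₂⟩ : ∃ c, c = cj (h 2) g := ⟨_, rfl⟩
  obtain ⟨c₃, hc₃⟩ : ∃ c, c = cj (h 3) g := ⟨_, rfl⟩
  obtain ⟨X₁, hX₁⟩ : ∃ Y, Y = c₀ • X := ⟨_, rfl⟩
  obtain ⟨X₂, hX₂⟩ : ∃ Y, Y = c₁ • X₁ := ⟨_, rfl⟩
  obtain ⟨X₃, hX₃⟩ : ∃ Y, Y = c₂ • X₂ := ⟨_, rfl⟩
  obtain ⟨X₄, hX₄⟩ : ∃ Y, Y = c₃ • X₃ := ⟨_, rfl⟩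
  obtain ⟨L, hL⟩ : ∃ L, L = K ∪ X ∪ X₁ ∪ X₂ ∪ X₃ ∪ X₄ := ⟨_, rfl⟩
  have l₀ : X ⊆ L := fun x hx => by simp [hL, hx]
  have l₁ : X₁ ⊆ L := fun x hx => by simp [hL, hx]
  have l₂ : X₂ ⊆ L := fun x hx => by simp [hL, hx]
  have l₃ : X₃ ⊆ L := fun x hx => by simp [hL, hx]
  have l₄ : X₄ ⊆ L := fun x hx => by simp [hL, hx]
  have lK : K ⊆ L := fun x hx => by simp [hL, hx]
  obtain ⟨s, hs, i₀⟩ := I.exists_ind X L y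
  obtain ⟨z₀, hz₀⟩ : ∃ z, z = s • y := ⟨_, rfl⟩
  rw [← hz₀] at i₀
  have n₀ : z₀ ∉ L := fun hL => hy <| by
    have := I.mem_of_self (i₀ _ hL)
    rwa [hz₀, ← smul_finset_of_mem_fixer hs subset_rfl, Finset.smul_mem_smul_finset_iff] at this
  obtain ⟨a₀, ha₀, n₁, i₁, -⟩ := (hc₀ ▸ hg.conj (h 0)).exists_step I l₀ (hX₁ ▸ l₁) n₀ i₀ z₀
  obtain ⟨z₁, hz₁⟩ : ∃ z, z = cj a₀ c₀ • z₀ := ⟨_, rfl⟩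
  rw [← hz₁] at n₁ i₁
  rw [← hX₁] at i₁
  obtain ⟨a₁, ha₁, n₂, i₂, j₂⟩ := (hc₁ ▸ hg.conj (h 1)).exists_step I l₁ (hX₂ ▸ l₂)
    (fun h => n₁ (Finset.mem_insert_of_mem h)) i₁ z₀
  obtain ⟨z₂, hz₂⟩ : ∃ z, z = cj a₁ c₁ • z₁ := ⟨_, rfl⟩
  rw [← hz₂] at n₂ i₂ j₂
  rw [← hX₂] at i₂
  obtain ⟨a₂, ha₂, n₃, i₃, j₃⟩ := (hc₂ ▸ hg.conj (h 2)).exists_step I l₂ (hX₃ ▸ l₃)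
    (fun h => n₂ (Finset.mem_insert_of_mem h)) i₂ z₀
  obtain ⟨z₃, hz₃⟩ : ∃ z, z = cj a₂ c₂ • z₂ := ⟨_, rfl⟩
  rw [← hz₃] at n₃ i₃ j₃
  rw [← hX₃] at i₃
  obtain ⟨a₃, ha₃, n₄, i₄, j₄⟩ := (hc₃ ▸ hg.conj (h 3)).exists_step I l₃ (hX₄ ▸ l₄)
    (fun h => n₃ (Finset.mem_insert_of_mem h)) i₃ z₀
  obtain ⟨z₄, hz₄⟩ : ∃ z, z = cj a₃ c₃ • z₃ := ⟨_, rfl⟩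
  rw [← hz₄] at n₄ i₄ j₄
  rw [← hX₄] at i₄
  have hmix : I.Ind L z₀ z₄ := I.mixing (fun h => n₁ (h ▸ Finset.mem_insert_self _ _))
    (I.symm j₂) n₂ (I.symm j₃) n₃ (I.symm j₄) n₄
  have hk : ∀ z : M, prodConj g ![a₀ * h 0, a₁ * h 1, a₂ * h 2, a₃ * h 3] • z =
      cj a₃ c₃ • cj a₂ c₂ • cj a₁ c₁ • cj a₀ c₀ • z := fun z => by
    rw [prodConj_smul, hc₀, hc₁, hc₂, hc₃]
    simp [cj_cj]
  have hkX : prodConj g ![a₀ * h 0, a₁ * h 1, a₂ * h 2, a₃ * h 3] • X = X₄ := by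
    have : ∀ x ∈ X, prodConj g ![a₀ * h 0, a₁ * h 1, a₂ * h 2, a₃ * h 3] • x =
        (c₃ * c₂ * c₁ * c₀) • x := by
      intro x hx
      have k₁ : c₀ • x ∈ X₁ := hX₁ ▸ Finset.smul_mem_smul_finset hx
      have k₂ : c₁ • c₀ • x ∈ X₂ := hX₂ ▸ Finset.smul_mem_smul_finset k₁
      have k₃ : c₂ • c₁ • c₀ • x ∈ X₃ := hX₃ ▸ Finset.smul_mem_smul_finset k₂
      have k₄ : c₃ • c₂ • c₁ • c₀ • x ∈ X₄ := hX₄ ▸ Finset.smul_mem_smul_finset k₃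
      rw [hk, cj_smul_of_fixer ha₀ (l₀ hx) (l₁ k₁), cj_smul_of_fixer ha₁ (l₁ k₁) (l₂ k₂),
        cj_smul_of_fixer ha₂ (l₂ k₂) (l₃ k₃), cj_smul_of_fixer ha₃ (l₃ k₃) (l₄ k₄)]
      simp [mul_smul]
    rw [smul_finset_eq_of_forall this, hX₄, hX₃, hX₂, hX₁]
    simp [mul_smul]
  refine ⟨![a₀ * h 0, a₁ * h 1, a₂ * h 2, a₃ * h 3], fun i => fixer_anti lK ?_, s, hs, ?_⟩
  · fin_cases i <;> simpa using ‹_›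
  rw [hkX, ← hz₀, hk, ← hz₁, ← hz₂, ← hz₃, ← hz₄]
  refine ⟨⟨I.trans i₄ (I.symm hmix), fun x hx => i₄ x (l₀ hx)⟩, I.trans i₀ hmix, fun x hx => ?_⟩
  refine i₀ _ (l₄ ?_)
  rw [← hkX]
  exact Finset.smul_mem_smul_finset hx

/-- If `g` moves all types, then some product of four conjugates of `g` moves maximally. -/
theorem MovesTypes.exists_mover [Countable M] (hG : IsClosedAction G M) {g : G}
    (hg : MovesTypes g M) (I : StationaryIndependence G M) :
    ∃ h : Fin 4 → G, I.Mover (prodConj g h) := by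
  rcases isEmpty_or_nonempty M with hM | hM
  · exact ⟨1, fun _ y => isEmptyElim y⟩
  obtain ⟨e, he⟩ := exists_surjective_nat (Finset M × M)
  have hnext : ∀ (S : (Fin 4 → G) × Finset M) (p : Finset M × M),
      ∃ S' : (Fin 4 → G) × Finset M, Near S.2 S.1 S'.1 ∧ S.2 ⊆ S'.2 ∧ p.2 ∈ S'.2 ∧
        (∀ i, S'.1 i • p.2 ∈ S'.2) ∧
        ∀ h, Near S'.2 S'.1 h → I.MoverAt (prodConj g h) p.1 p.2 := by
    rintro ⟨h, K⟩ ⟨X, y⟩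
    obtain ⟨h', hh', hm⟩ := hg.exists_moverAt I h K X y
    obtain ⟨s, hs, hm⟩ := hm
    obtain ⟨T, hT⟩ := exists_finset_prodConj_eq g h' (insert (s • y) X)
    refine ⟨⟨h', K ∪ T ∪ {y} ∪ Finset.univ.image fun i => h' i • y⟩, hh', ?_, ?_, ?_, ?_⟩
    · intro k hk
      simp [hk]
    · simp
    · simp
    · intro h'' hh''
      have hT' := hT h'' (hh''.anti (fun k hk => by simp [hk]))
      refine ⟨s, hs, ?_⟩
      rw [hT' _ (Finset.mem_insert_self _ _),
        smul_finset_eq_of_forall fun x hx => hT' x (Finset.mem_insert_of_mem hx)]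
      refine ⟨hm.1, hm.2.1, fun x hx => ?_⟩
      rw [hT' x (Finset.mem_insert_of_mem hx)]
      exact hm.2.2 x hx
  choose next h₁ h₂ h₃ h₄ h₅ using hnext
  let S : ℕ → (Fin 4 → G) × Finset M := fun t => Nat.rec (1, ∅) (fun t s => next s (e t)) t
  have mX : Monotone fun t => (S t).2 := monotone_nat_of_le_succ fun t => h₂ _ _
  obtain ⟨u, hu⟩ := hG.exists_limit_near (h := fun t => (S t).1) mX (fun t => h₁ _ _)
    (fun m => by
      obtain ⟨t, ht⟩ := he (∅, m)
      have := h₃ (S t) (e t)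
      rw [ht] at this
      exact ⟨t + 1, by simpa only [S, ht] using this⟩)
    (fun m => by
      obtain ⟨t, ht⟩ := he (∅, m)
      have := h₄ (S t) (e t)
      rw [ht] at this
      exact ⟨t + 1, by simpa only [S, ht] using this⟩)
  refine ⟨u, fun X y => ?_⟩
  obtain ⟨t, ht⟩ := he (X, y)
  have := h₅ (S t) (e t) u (hu (t + 1))
  rwa [ht] at this

/-- In a closed group with a stationary independence relation, a normal subgroup that contains an
element moving all types is the whole group. -/
theorem eq_top_of_movesTypes [Countable M] [FaithfulSMul G M] (I : StationaryIndependence G M)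
    (hG : IsClosedAction G M) (N : Subgroup G) [N.Normal] {g : G} (hgN : g ∈ N)
    (hg : MovesTypes g M) : N = ⊤ := by
  obtain ⟨h, hh⟩ := hg.exists_mover hG I
  obtain ⟨Y, hY⟩ := hh.exists_prodConj_eq hG
  refine I.eq_top_of_fixer_le N (Y := Y) fun F hF => ?_
  obtain ⟨u, v, huv⟩ := hY F hF
  have hk := prodConj_mem hgN h
  have : F = prodConj (prodConj g h) v * (prodConj (prodConj g h) u)⁻¹ := by
    rw [eq_mul_inv_iff_mul_eq]
    exact FaithfulSMul.eq_of_smul_eq_smul fun z : M => by rw [mul_smul, huv z]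
  rw [this]
  exact mul_mem (prodConj_mem hk v) (inv_mem (prodConj_mem hk u))

end StationaryIndependence

/-! ### Prioritised amalgamation of colours -/

section Colours

variable {C M : Type*} {ok : C → C → C → Prop} {p₁ p₂ p₃ : C}

/-- Two pairs of colours can occur as the pairs of colours that join two points of a base to two
given further points. -/
def Compatible (ok : C → C → C → Prop) (a c a' c' : C) : Prop :=
  (a = a' ∧ c = c') ∨ ∃ d, ok a a' d ∧ ok c c' d

/-- The finitely many conditions on the set of allowed triangles, where `ok a b c` says that the
triangle with colours `a`, `b`, `c` is allowed, which ensure that any two one-point extensions can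
be amalgamated by means of the colours `p₁`, `p₂`, `p₃` in this order of preference, and that this
amalgamation gives a stationary independence relation.  The colours `p₂` and `p₃` may coincide.
In the fields `double` to `trans₃₂`, the colours `a`, `c` (and `a'`, `c'`) join two points to the
same point `b` of the base, so that `¬ ok a c p` says that `b` blocks the colour `p` for their
edge.  By `double` and `not_blocked`, if `p₁` and `p₂` are both blocked, then a single point
blocks them, and `p₃` is not blocked.  The fields `trans₂`, `trans₃₁`, `trans₃₂` say that an
obstruction coming from a point which is joined by a preferred colour comes from the base
already. -/
structure IsPrioritised (ok : C → C → C → Prop) (p₁ p₂ p₃ : C) : Prop where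
  swap₁₂ : ∀ a b c, ok a b c → ok b a c
  swap₂₃ : ∀ a b c, ok a b c → ok a c b
  ne : p₁ ≠ p₂
  free₁ : ∀ c, ok p₁ p₁ c
  free₂ : ∀ c, ok p₁ p₂ c
  double : ∀ a c a' c', ¬ ok a c p₁ → ¬ ok a' c' p₂ → Compatible ok a c a' c' →
    ¬ ok a c p₂ ∨ ¬ ok a' c' p₁
  not_blocked : ∀ a c a' c', ¬ ok a c p₁ → ¬ ok a c p₂ → Compatible ok a c a' c' → ok a' c' p₃
  double_ne : ∀ a c, ¬ ok a c p₁ → ¬ ok a c p₂ → a ≠ p₁ ∧ a ≠ p₂ ∧ a ≠ p₃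
  trans₂ : p₂ ≠ p₃ → ∀ a c d e, ¬ ok a c p₁ → ok a c p₂ → ok c d e → ¬ ok p₂ e p₂ → ¬ ok a d p₂
  trans₃₁ : ∀ a c d e, ¬ ok a c p₁ → ¬ ok a c p₂ → ok c d e → ¬ ok p₃ e p₁ → ¬ ok a d p₁
  trans₃₂ : ∀ a c d e, ¬ ok a c p₁ → ¬ ok a c p₂ → ok c d e → ¬ ok p₃ e p₂ → ¬ ok a d p₂

/-- A complete edge colouring of `M` in which all triangles are allowed; the values `col x x`
have no meaning. -/
structure IsColouring (ok : C → C → C → Prop) (col : M → M → C) : Prop where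
  symm : ∀ x y, col x y = col y x
  triangle : ∀ x y z, x ≠ y → x ≠ z → y ≠ z → ok (col x y) (col x z) (col y z)

/-- `u` gives the colours from a new point to the points of `B`, without forbidden triangles. -/
def IsType (ok : C → C → C → Prop) (col : M → M → C) (B : Finset M) (u : M → C) : Prop :=
  ∀ b ∈ B, ∀ b' ∈ B, b ≠ b' → ok (u b) (u b') (col b b')

/-- The colour `p` cannot be given to the edge between two points that are joined to the points
of `B` by the colours `u` and `v`. -/
def Blocked (ok : C → C → C → Prop) (B : Finset M) (u v : M → C) (p : C) : Prop :=
  ∃ b ∈ B, ¬ ok (u b) (v b) p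

open Classical in
/-- The first of the colours `p₁`, `p₂`, `p₃` that is not blocked over `B`. -/
noncomputable def freeColour (ok : C → C → C → Prop) (p₁ p₂ p₃ : C) (B : Finset M) (u v : M → C) :
    C :=
  if Blocked ok B u v p₁ then if Blocked ok B u v p₂ then p₃ else p₂ else p₁

variable {B B' : Finset M} {u v u' v' : M → C} {col : M → M → C} {p : C}

theorem Blocked.mono (h : B ⊆ B') (hb : Blocked ok B u v p) : Blocked ok B' u v p :=
  hb.imp fun _ hb => ⟨h hb.1, hb.2⟩

theorem blocked_insert [DecidableEq M] {s : M} :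
    Blocked ok (insert s B) u v p ↔ ¬ ok (u s) (v s) p ∨ Blocked ok B u v p := by
  simp [Blocked]

theorem blocked_congr (hu : ∀ b ∈ B, u b = u' b) (hv : ∀ b ∈ B, v b = v' b) :
    Blocked ok B u v p ↔ Blocked ok B u' v' p := by
  refine exists_congr fun b => and_congr_right fun hb => ?_
  rw [hu b hb, hv b hb]

theorem freeColour_congr (h : ∀ p, Blocked ok B u v p ↔ Blocked ok B' u' v' p) :
    freeColour ok p₁ p₂ p₃ B u v = freeColour ok p₁ p₂ p₃ B' u' v' := by
  classical
  rw [freeColour, freeColour]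
  simp only [h]

theorem freeColour_cases (ok : C → C → C → Prop) (p₁ p₂ p₃ : C) (B : Finset M) (u v : M → C) :
    (freeColour ok p₁ p₂ p₃ B u v = p₁ ∧ ¬ Blocked ok B u v p₁) ∨
    (freeColour ok p₁ p₂ p₃ B u v = p₂ ∧ Blocked ok B u v p₁ ∧ ¬ Blocked ok B u v p₂) ∨
    (freeColour ok p₁ p₂ p₃ B u v = p₃ ∧ Blocked ok B u v p₁ ∧ Blocked ok B u v p₂) := by
  rw [freeColour]
  split_ifs <;> simp [*]

theorem freeColour_eq₁ (h : ¬ Blocked ok B u v p₁) : freeColour ok p₁ p₂ p₃ B u v = p₁ := by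
  rw [freeColour, if_neg h]

theorem freeColour_eq₂ (h₁ : Blocked ok B u v p₁) (h₂ : ¬ Blocked ok B u v p₂) :
    freeColour ok p₁ p₂ p₃ B u v = p₂ := by
  rw [freeColour, if_pos h₁, if_neg h₂]

theorem freeColour_eq₃ (h₁ : Blocked ok B u v p₁) (h₂ : Blocked ok B u v p₂) :
    freeColour ok p₁ p₂ p₃ B u v = p₃ := by
  rw [freeColour, if_pos h₁, if_pos h₂]

/-- Over a larger base the colour stays the same unless it becomes blocked. -/
theorem freeColour_mono (h : B ⊆ B')
    (hB : ¬ Blocked ok B' u v (freeColour ok p₁ p₂ p₃ B u v)) :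
    freeColour ok p₁ p₂ p₃ B' u v = freeColour ok p₁ p₂ p₃ B u v := by
  rcases freeColour_cases ok p₁ p₂ p₃ B u v with ⟨e, h₁⟩ | ⟨e, h₁, h₂⟩ | ⟨e, h₁, h₂⟩ <;>
    rw [e] at hB ⊢
  · exact freeColour_eq₁ hB
  · exact freeColour_eq₂ (h₁.mono h) hB
  · exact freeColour_eq₃ (h₁.mono h) (h₂.mono h)

theorem IsType.compatible (hu : IsType ok col B u) (hv : IsType ok col B v) {b b' : M}
    (hb : b ∈ B) (hb' : b' ∈ B) : Compatible ok (u b) (v b) (u b') (v b') := by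
  by_cases h : b = b'
  · exact Or.inl (by rw [h]; simp)
  · exact Or.inr ⟨_, hu b hb b' hb' h, hv b hb b' hb' h⟩

theorem IsType.mono (h : B ⊆ B') (hu : IsType ok col B' u) : IsType ok col B u :=
  fun b hb b' hb' => hu b (h hb) b' (h hb')

theorem IsColouring.isType (hc : IsColouring ok col) {x : M} (hx : x ∉ B) :
    IsType ok col B (col x) :=
  fun b hb b' hb' h => hc.triangle x b b' (fun e => hx (e ▸ hb)) (fun e => hx (e ▸ hb')) h

theorem IsColouring.not_blocked (hc : IsColouring ok col) {x y : M} (hx : x ∉ B) (hy : y ∉ B)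
    (hxy : x ≠ y) (H : IsPrioritised ok p₁ p₂ p₃) :
    ¬ Blocked ok B (col x) (col y) (col x y) := by
  rintro ⟨b, hb, h⟩
  exact h (H.swap₂₃ _ _ _ (H.swap₁₂ _ _ _
    (hc.triangle x y b hxy (fun e => hx (e ▸ hb)) (fun e => hy (e ▸ hb)))))

namespace IsPrioritised

variable (H : IsPrioritised ok p₁ p₂ p₃)
include H

theorem swap₁₃ {a b c : C} (h : ok a b c) : ok c b a :=
  H.swap₁₂ _ _ _ (H.swap₂₃ _ _ _ (H.swap₁₂ _ _ _ h))

theorem rotate {a b c : C} (h : ok a b c) : ok b c a :=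
  H.swap₂₃ _ _ _ (H.swap₁₂ _ _ _ h)

theorem blocked_comm : Blocked ok B u v p ↔ Blocked ok B v u p :=
  exists_congr fun _ => and_congr_right fun _ => not_congr ⟨H.swap₁₂ _ _ _, H.swap₁₂ _ _ _⟩

theorem freeColour_comm : freeColour ok p₁ p₂ p₃ B u v = freeColour ok p₁ p₂ p₃ B v u :=
  freeColour_congr fun _ => H.blocked_comm

/-- If the first two colours are blocked over a base, then they are blocked by a single point. -/
theorem exists_double (hu : IsType ok col B u) (hv : IsType ok col B v)
    (h₁ : Blocked ok B u v p₁) (h₂ : Blocked ok B u v p₂) :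
    ∃ b ∈ B, ¬ ok (u b) (v b) p₁ ∧ ¬ ok (u b) (v b) p₂ := by
  obtain ⟨b, hb, h₁⟩ := h₁
  obtain ⟨b', hb', h₂⟩ := h₂
  rcases H.double _ _ _ _ h₁ h₂ (hu.compatible hv hb hb') with h | h
  exacts [⟨b, hb, h₁, h⟩, ⟨b', hb', h, h₂⟩]

theorem not_blocked_freeColour (hu : IsType ok col B u) (hv : IsType ok col B v) :
    ¬ Blocked ok B u v (freeColour ok p₁ p₂ p₃ B u v) := by
  rcases freeColour_cases ok p₁ p₂ p₃ B u v with ⟨e, h₁⟩ | ⟨e, h₁, h₂⟩ | ⟨e, h₁, h₂⟩ <;> rw [e]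
  · exact h₁
  · exact h₂
  · rintro ⟨b', hb', h₃⟩
    obtain ⟨b, hb, h₁, h₂⟩ := H.exists_double hu hv h₁ h₂
    exact h₃ (H.not_blocked _ _ _ _ h₁ h₂ (hu.compatible hv hb hb'))

/-- A point `s` that is independent over `B` from the point of type `u` does not influence the
colour of the amalgam of `u` with any other type. -/
theorem freeColour_insert [DecidableEq M] (hc : IsColouring ok col) {s : M} (hs : s ∉ B)
    (hu : IsType ok col (insert s B) u) (hv : IsType ok col (insert s B) v)
    (hus : u s = freeColour ok p₁ p₂ p₃ B u (col s)) :
    freeColour ok p₁ p₂ p₃ (insert s B) u v = freeColour ok p₁ p₂ p₃ B u v := by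
  have huB := hu.mono (Finset.subset_insert s B)
  have htri : ∀ b ∈ B, ok (col s b) (v b) (v s) := fun b hb =>
    H.swap₁₃ (hv s (Finset.mem_insert_self _ _) b (Finset.mem_insert_of_mem hb)
      (fun e => hs (e ▸ hb)))
  have claim₁ : ¬ ok (u s) (v s) p₁ → Blocked ok B u v p₁ := by
    intro h
    rcases freeColour_cases ok p₁ p₂ p₃ B u (col s) with ⟨e, -⟩ | ⟨e, -⟩ | ⟨e, h₁, h₂⟩ <;>
      rw [hus, e] at h
    · exact absurd (H.swap₂₃ _ _ _ (H.free₁ _)) h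
    · exact absurd (H.rotate (H.free₂ _)) h
    · obtain ⟨b, hb, h₁, h₂⟩ := H.exists_double huB (hc.isType hs) h₁ h₂
      exact ⟨b, hb, H.trans₃₁ _ _ _ _ h₁ h₂ (htri b hb) h⟩
  have claim₂ : p₂ ≠ p₃ → ¬ ok (u s) (v s) p₂ → Blocked ok B u v p₂ := by
    intro h₂₃ h
    rcases freeColour_cases ok p₁ p₂ p₃ B u (col s) with ⟨e, -⟩ | ⟨e, h₁, h₂⟩ | ⟨e, h₁, h₂⟩ <;>
      rw [hus, e] at h
    · exact absurd (H.swap₂₃ _ _ _ (H.free₂ _)) h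
    · obtain ⟨b, hb, h₁⟩ := h₁
      have h₂' : ok (u b) (col s b) p₂ := by_contra fun h' => h₂ ⟨b, hb, h'⟩
      exact ⟨b, hb, H.trans₂ h₂₃ _ _ _ _ h₁ h₂' (htri b hb) h⟩
    · obtain ⟨b, hb, h₁, h₂⟩ := H.exists_double huB (hc.isType hs) h₁ h₂
      exact ⟨b, hb, H.trans₃₂ _ _ _ _ h₁ h₂ (htri b hb) h⟩
  have e₁ : Blocked ok (insert s B) u v p₁ ↔ Blocked ok B u v p₁ := by
    rw [blocked_insert]
    exact ⟨fun h => h.elim claim₁ id, Or.inr⟩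
  by_cases h₁ : Blocked ok B u v p₁
  · by_cases h₂₃ : p₂ = p₃
    · rw [freeColour, freeColour, if_pos h₁, if_pos (e₁.2 h₁), h₂₃, ite_self, ite_self]
    · have e₂ : Blocked ok (insert s B) u v p₂ ↔ Blocked ok B u v p₂ := by
        rw [blocked_insert]
        exact ⟨fun h => h.elim (claim₂ h₂₃) id, Or.inr⟩
      by_cases h₂ : Blocked ok B u v p₂
      · rw [freeColour_eq₃ h₁ h₂, freeColour_eq₃ (e₁.2 h₁) (e₂.2 h₂)]
      · rw [freeColour_eq₂ h₁ h₂, freeColour_eq₂ (e₁.2 h₁) (mt e₂.1 h₂)]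
  · rw [freeColour_eq₁ h₁, freeColour_eq₁ (mt e₁.1 h₁)]

/-- The free extension of a type over `B` to all points. -/
theorem isType_extend [DecidableEq M] (hc : IsColouring ok col) (hu : IsType ok col B u)
    (D : Finset M) :
    IsType ok col D (fun d => if d ∈ B then u d else freeColour ok p₁ p₂ p₃ B u (col d)) := by
  set u' : M → C := fun d => if d ∈ B then u d else freeColour ok p₁ p₂ p₃ B u (col d) with hu'
  have huB : ∀ b ∈ B, u' b = u b := fun b hb => if_pos hb
  have huB' : ∀ b, b ∉ B → u' b = freeColour ok p₁ p₂ p₃ B u (col b) := fun b hb => if_neg hb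
  have one : ∀ b ∈ B, ∀ d, d ∉ B → ok (u' b) (u' d) (col b d) := by
    intro b hb d hd
    have := H.not_blocked_freeColour hu (hc.isType hd)
    rw [huB b hb, huB' d hd, hc.symm b d]
    exact H.swap₂₃ _ _ _ (by_contra fun h => this ⟨b, hb, h⟩)
  intro b _ d _ hbd
  by_cases hb : b ∈ B <;> by_cases hd : d ∈ B
  · rw [huB b hb, huB d hd]
    exact hu b hb d hd hbd
  · exact one b hb d hd
  · rw [hc.symm b d]
    exact H.swap₁₂ _ _ _ (one d hd b hb)
  · have hins : IsType ok col (insert b B) u' := by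
      intro x hx y hy hxy
      rcases Finset.mem_insert.1 hx with hx' | hx' <;>
        rcases Finset.mem_insert.1 hy with hy' | hy'
      · exact absurd (hx'.trans hy'.symm) hxy
      · rw [hx', hc.symm b y]
        exact H.swap₁₂ _ _ _ (one y hy' b hb)
      · rw [hy']
        exact one x hx' b hb
      · rw [huB x hx', huB y hy']
        exact hu x hx' y hy' hxy
    have hd' : d ∉ insert b B := by
      rw [Finset.mem_insert, not_or]
      exact ⟨hbd.symm, hd⟩
    have hcongr : ∀ w, freeColour ok p₁ p₂ p₃ B u' w = freeColour ok p₁ p₂ p₃ B u w := fun w =>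
      freeColour_congr fun _ => blocked_congr huB fun _ _ => rfl
    have h := H.not_blocked_freeColour hins (hc.isType hd')
    rw [H.freeColour_insert hc hb hins (hc.isType hd') (by rw [hcongr]; exact huB' b hb), hcongr,
      ← huB' d hd] at h
    rw [hc.symm b d]
    exact H.swap₂₃ _ _ _ (by_contra fun h' => h ⟨b, Finset.mem_insert_self _ _, h'⟩)

end IsPrioritised

/-! ### The independence relation of a homogeneous coloured structure -/

/-- Points `x` and `y` are independent over `B` if one of them belongs to `B`, or their edge has
the colour that is preferred over `B`. -/
def ColourInd (ok : C → C → C → Prop) (p₁ p₂ p₃ : C) (col : M → M → C) (B : Finset M) (x y : M) :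
    Prop :=
  x ∈ B ∨ y ∈ B ∨ (x ≠ y ∧ col x y = freeColour ok p₁ p₂ p₃ B (col x) (col y))

/-- `M` with the colouring `col` is generic and homogeneous for the group `G`: all types over
finite sets are realised, `G` preserves the colouring, and finite partial isomorphisms extend to
elements of `G`. -/
structure IsGenericColouring (ok : C → C → C → Prop) (col : M → M → C) (G : Type*) [Group G]
    [MulAction G M] : Prop extends IsColouring ok col where
  exists_point : ∀ (B : Finset M) (u : M → C), IsType ok col B u →
    ∃ z, z ∉ B ∧ ∀ b ∈ B, col z b = u b
  smul : ∀ (g : G) (x y : M), x ≠ y → col (g • x) (g • y) = col x y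
  exists_extension : ∀ (B : Finset M) (f : M → M), Set.InjOn f B →
    (∀ x ∈ B, ∀ y ∈ B, x ≠ y → col (f x) (f y) = col x y) → ∃ g : G, ∀ b ∈ B, g • b = f b

variable {G : Type*} [Group G] [MulAction G M]

/-- An element of the group that fixes `B` and moves `x` to a point of the same type. -/
theorem IsGenericColouring.exists_fixer (hc : IsGenericColouring ok col G) {x z : M} (hx : x ∉ B)
    (hz : z ∉ B) (h : ∀ b ∈ B, col z b = col x b) : ∃ g ∈ fixer G B, g • x = z := by
  classical
  have hb : ∀ b ∈ B, b ≠ x := fun b hb e => hx (e ▸ hb)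
  obtain ⟨g, hg⟩ := hc.exists_extension (insert x B) (fun b => if b = x then z else b)
    (by
      intro a ha b hb' hab
      simp only [Finset.coe_insert, Set.mem_insert_iff, Finset.mem_coe] at ha hb'
      simp only at hab
      split_ifs at hab with h₁ h₂ h₂
      · rw [h₁, h₂]
      · exact absurd (hab ▸ hb'.resolve_left h₂) hz
      · exact absurd (hab ▸ ha.resolve_left h₁) hz
      · exact hab)
    (by
      intro a ha' b hb' hab
      rcases Finset.mem_insert.1 ha' with e | ha <;> rcases Finset.mem_insert.1 hb' with e' | hb'
      · exact absurd (e.trans e'.symm) hab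
      · rw [if_pos e, if_neg (hb b hb'), h b hb', e]
      · rw [if_pos e', if_neg (hb a ha), hc.symm a z, h a ha, hc.symm x a, e']
      · rw [if_neg (hb a ha), if_neg (hb b hb')])
  refine ⟨g, mem_fixer.2 fun b hb' => ?_, ?_⟩
  · rw [hg b (Finset.mem_insert_of_mem hb'), if_neg (hb b hb')]
  · rw [hg x (Finset.mem_insert_self _ _), if_pos rfl]

theorem ColourInd.mono (H : IsPrioritised ok p₁ p₂ p₃) (hc : IsColouring ok col) {x y : M}
    (hB : B ⊆ B') (h : ColourInd ok p₁ p₂ p₃ col B x y) : ColourInd ok p₁ p₂ p₃ col B' x y := by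
  by_cases hx : x ∈ B'
  · exact Or.inl hx
  by_cases hy : y ∈ B'
  · exact Or.inr (Or.inl hy)
  rcases h with h | h | ⟨hxy, h⟩
  · exact Or.inl (hB h)
  · exact Or.inr (Or.inl (hB h))
  · refine Or.inr (Or.inr ⟨hxy, ?_⟩)
    have := hc.not_blocked hx hy hxy H
    rw [h] at this
    rw [freeColour_mono hB this, h]

theorem ColourInd.trans [DecidableEq M] (H : IsPrioritised ok p₁ p₂ p₃) (hc : IsColouring ok col)
    {x y : M} (hB : ∀ b ∈ B', ColourInd ok p₁ p₂ p₃ col B x b)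
    (h : ColourInd ok p₁ p₂ p₃ col B' x y) : ColourInd ok p₁ p₂ p₃ col B x y := by
  by_cases hx : x ∈ B
  · exact Or.inl hx
  by_cases hy : y ∈ B
  · exact Or.inr (Or.inl hy)
  have hx' : x ∉ B' := fun h' => by
    rcases hB x h' with h | h | h
    exacts [hx h, hx h, h.1 rfl]
  by_cases hy' : y ∈ B'
  · exact hB y hy'
  have key : ∀ T ⊆ B', freeColour ok p₁ p₂ p₃ (B ∪ T) (col x) (col y) =
      freeColour ok p₁ p₂ p₃ B (col x) (col y) := by
    intro T
    induction T using Finset.induction_on with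
    | empty => simp
    | insert s T _ ih =>
      intro hT
      obtain ⟨hs, hT⟩ := Finset.insert_subset_iff.1 hT
      rw [Finset.union_insert]
      by_cases hsT : s ∈ B ∪ T
      · rw [Finset.insert_eq_of_mem hsT, ih hT]
      rw [← ih hT]
      have hxT : x ∉ insert s (B ∪ T) := by
        intro h'
        rcases Finset.mem_insert.1 h' with rfl | h'
        · exact hx' hs
        · exact (Finset.mem_union.1 h').elim hx fun h => hx' (hT h)
      have hyT : y ∉ insert s (B ∪ T) := by
        intro h'
        rcases Finset.mem_insert.1 h' with rfl | h'
        · exact hy' hs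
        · exact (Finset.mem_union.1 h').elim hy fun h => hy' (hT h)
      refine H.freeColour_insert hc hsT (hc.isType hxT) (hc.isType hyT) ?_
      rcases ColourInd.mono H hc (Finset.subset_union_left (s₂ := T)) (hB s hs) with h | h | h
      · exact absurd (Finset.mem_insert_of_mem h) hxT
      · exact absurd h hsT
      · exact h.2
  rcases ColourInd.mono H hc (Finset.subset_union_right (s₁ := B)) h with h | h | h
  · exact absurd h (by simp [hx, hx'])
  · exact absurd h (by simp [hy, hy'])
  · exact Or.inr (Or.inr ⟨h.1, by rw [h.2, key B' subset_rfl]⟩)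

/-- If the preferred colour over `insert w B` is the last one, then it is so already over `B`,
because the point that blocks the first two colours is not joined to `x` by a preferred colour. -/
theorem colourInd_of_mem_priority [DecidableEq M] (H : IsPrioritised ok p₁ p₂ p₃)
    (hc : IsColouring ok col) {x w w' : M} (hx : x ∉ insert w B) (hw' : w' ∉ insert w B)
    (hw : col x w = p₁ ∨ col x w = p₂ ∨ col x w = p₃)
    (h : ColourInd ok p₁ p₂ p₃ col (insert w B) x w') :
    ColourInd ok p₁ p₂ p₃ col B x w' ∨ col x w' = p₁ ∨ col x w' = p₂ := by
  obtain ⟨hne, h⟩ := (h.resolve_left hx).resolve_left hw'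
  rcases freeColour_cases ok p₁ p₂ p₃ (insert w B) (col x) (col w') with
    ⟨e, -⟩ | ⟨e, -⟩ | ⟨e, h₁, h₂⟩
  · exact Or.inr (Or.inl (h.trans e))
  · exact Or.inr (Or.inr (h.trans e))
  · left
    obtain ⟨b, hb, h₁, h₂⟩ := H.exists_double (hc.isType hx) (hc.isType hw') h₁ h₂
    have hbB : b ∈ B := by
      refine (Finset.mem_insert.1 hb).resolve_left fun e => ?_
      have := H.double_ne _ _ h₁ h₂
      rw [e] at this
      tauto
    exact Or.inr (Or.inr ⟨hne, by rw [h, e, freeColour_eq₃ ⟨b, hbB, h₁⟩ ⟨b, hbB, h₂⟩]⟩)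

/-- If `x` is joined to `w` by one of the first two colours, then `w` does not contribute to the
preferred colour over `insert w B`. -/
theorem colourInd_of_first [DecidableEq M] (H : IsPrioritised ok p₁ p₂ p₃)
    (hc : IsColouring ok col) {x w w' : M} (hx : x ∉ insert w B) (hw' : w' ∉ insert w B)
    (hw : col x w = p₁ ∨ col x w = p₂) (h : ColourInd ok p₁ p₂ p₃ col (insert w B) x w') :
    ColourInd ok p₁ p₂ p₃ col B x w' := by
  obtain ⟨hne, -⟩ := id ((h.resolve_left hx).resolve_left hw')
  have hsub := Finset.subset_insert w B
  rcases colourInd_of_mem_priority H hc hx hw' (hw.imp_right Or.inl) h with h₁ | h₁ | h₂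
  · exact h₁
  · have hn := hc.not_blocked hx hw' hne H
    rw [h₁] at hn
    exact Or.inr (Or.inr ⟨hne, by rw [h₁, freeColour_eq₁ fun h' => hn (h'.mono hsub)]⟩)
  · have hn := hc.not_blocked hx hw' hne H
    rw [h₂] at hn
    have hb : Blocked ok (insert w B) (col x) (col w') p₁ := by
      by_contra hb
      have := ((h.resolve_left hx).resolve_left hw').2
      rw [h₂, freeColour_eq₁ hb] at this
      exact H.ne this.symm
    have hb' : Blocked ok B (col x) (col w') p₁ := by
      refine (blocked_insert.1 hb).resolve_left fun h' => h' ?_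
      rcases hw with e | e <;> rw [e]
      · exact H.swap₂₃ _ _ _ (H.free₁ _)
      · exact H.rotate (H.free₂ _)
    exact Or.inr (Or.inr ⟨hne, by rw [h₂, freeColour_eq₂ hb' fun h' => hn (h'.mono hsub)]⟩)

/-- The stationary independence relation given by a prioritised amalgamation. -/
def IsGenericColouring.stationaryIndependence [DecidableEq M] (H : IsPrioritised ok p₁ p₂ p₃)
    (hc : IsGenericColouring ok col G) : StationaryIndependence G M where
  Ind := ColourInd ok p₁ p₂ p₃ col
  smul g {B x y} h := by
    rcases h with h | h | ⟨hxy, h⟩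
    · exact Or.inl (Finset.smul_mem_smul_finset h)
    · exact Or.inr (Or.inl (Finset.smul_mem_smul_finset h))
    by_cases hx : x ∈ B
    · exact Or.inl (Finset.smul_mem_smul_finset hx)
    by_cases hy : y ∈ B
    · exact Or.inr (Or.inl (Finset.smul_mem_smul_finset hy))
    refine Or.inr (Or.inr ⟨fun e => hxy (MulAction.injective g e), ?_⟩)
    rw [hc.smul g x y hxy, h]
    refine freeColour_congr fun p => ?_
    have e : ∀ b ∈ B, col (g • x) (g • b) = col x b ∧ col (g • y) (g • b) = col y b :=
      fun b hb => ⟨hc.smul g x b fun e => hx (e ▸ hb), hc.smul g y b fun e => hy (e ▸ hb)⟩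
    constructor
    · rintro ⟨b, hb, h⟩
      exact ⟨g • b, Finset.smul_mem_smul_finset hb, by rwa [(e b hb).1, (e b hb).2]⟩
    · rintro ⟨b', hb', h⟩
      obtain ⟨b, hb, rfl⟩ := Finset.mem_smul_finset.1 hb'
      exact ⟨b, hb, by rwa [(e b hb).1, (e b hb).2] at h⟩
  symm {B x y} h := by
    rcases h with h | h | ⟨hxy, h⟩
    · exact Or.inr (Or.inl h)
    · exact Or.inl h
    · exact Or.inr (Or.inr ⟨hxy.symm, by rw [hc.symm, h, H.freeColour_comm]⟩)
  of_mem h := Or.inr (Or.inl h)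
  mem_of_self {B x} h := by
    rcases h with h | h | h
    exacts [h, h, absurd rfl h.1]
  mono hB h := ColourInd.mono H hc.toIsColouring hB h
  trans hB h := ColourInd.trans H hc.toIsColouring hB h
  exists_ind B D x := by
    classical
    by_cases hx : x ∈ B
    · exact ⟨1, one_mem _, fun d _ => Or.inl (by rwa [one_smul])⟩
    obtain ⟨z, hz, hz'⟩ := hc.exists_point (B ∪ D) _
      (H.isType_extend hc.toIsColouring (hc.isType hx) (B ∪ D))
    have hzB : ∀ b ∈ B, col z b = col x b := fun b hb => by
      rw [hz' b (Finset.mem_union_left _ hb), if_pos hb]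
    obtain ⟨g, hg, rfl⟩ := hc.exists_fixer hx (fun h => hz (Finset.mem_union_left _ h)) hzB
    refine ⟨g, hg, fun d hd => ?_⟩
    by_cases hdB : d ∈ B
    · exact Or.inr (Or.inl hdB)
    refine Or.inr (Or.inr ⟨fun e => hz (e ▸ Finset.mem_union_right _ hd), ?_⟩)
    rw [hz' d (Finset.mem_union_right _ hd), if_neg hdB]
    exact freeColour_congr fun p => blocked_congr (fun b hb => (hzB b hb).symm) fun _ _ => rfl
  stationary {B D x h} hh h₁ h₂ := by
    by_cases hx : x ∈ B
    · exact ⟨1, one_mem _, by rw [one_smul, smul_eq_of_mem_fixer hh hx]⟩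
    have hhx : h • x ∉ B := fun h' => hx (by
      have := inv_smul_eq_of_mem_fixer hh h'
      rw [inv_smul_smul] at this
      rwa [this])
    have hB : ∀ b ∈ B, col (h • x) b = col x b := fun b hb => by
      have := hc.smul h x b fun e => hx (e ▸ hb)
      rwa [smul_eq_of_mem_fixer hh hb] at this
    have aux : ∀ {z d}, z ∉ B → d ∈ D → ColourInd ok p₁ p₂ p₃ col B z d → z ≠ d ∨ d ∈ B := by
      intro z d hz _ h
      rcases h with h | h | h
      exacts [absurd h hz, Or.inr h, Or.inl h.1]
    have hxD : x ∉ B ∪ D := fun h' => by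
      rcases Finset.mem_union.1 h' with h' | h'
      · exact hx h'
      · exact (aux hx h' (h₁ x h')).elim (fun e => e rfl) hx
    have hhxD : h • x ∉ B ∪ D := fun h' => by
      rcases Finset.mem_union.1 h' with h' | h'
      · exact hhx h'
      · exact (aux hhx h' (h₂ _ h')).elim (fun e => e rfl) hhx
    refine hc.exists_fixer hxD hhxD fun d hd => ?_
    by_cases hdB : d ∈ B
    · exact hB d hdB
    replace hd := (Finset.mem_union.1 hd).resolve_left hdB
    have e₁ := (((h₁ d hd).resolve_left hx).resolve_left hdB).2
    have e₂ := (((h₂ d hd).resolve_left hhx).resolve_left hdB).2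
    rw [e₁, e₂]
    exact freeColour_congr fun p => blocked_congr hB fun _ _ => rfl
  mixing {B x w₁ w₂ w₃ w₄} hw₁ h₂ hw₂ h₃ hw₃ h₄ hw₄ := by
    by_cases hx : x ∈ B
    · exact Or.inl hx
    have not_mem : ∀ {w}, w ≠ x → x ∉ insert w B := fun hw h =>
      (Finset.mem_insert.1 h).elim (fun e => hw e.symm) hx
    obtain ⟨hne₂, e₂⟩ := (h₂.resolve_left (not_mem hw₁)).resolve_left hw₂
    have hx₂ := not_mem hne₂.symm
    have hx₃ := not_mem ((h₃.resolve_left hx₂).resolve_left hw₃).1.symm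
    have hcol₂ : col x w₂ = p₁ ∨ col x w₂ = p₂ ∨ col x w₂ = p₃ := by
      rw [e₂]
      rcases freeColour_cases ok p₁ p₂ p₃ (insert w₁ B) (col x) (col w₂) with h | h | h
      exacts [Or.inl h.1, Or.inr (Or.inl h.1), Or.inr (Or.inr h.1)]
    rcases colourInd_of_mem_priority H hc.toIsColouring hx₂ hw₃ hcol₂ h₃ with h | h
    · refine ColourInd.trans H hc.toIsColouring (B' := insert w₃ B) (fun b hb => ?_) h₄
      rcases Finset.mem_insert.1 hb with rfl | hb
      exacts [h, Or.inr (Or.inl hb)]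
    · exact colourInd_of_first H hc.toIsColouring hx₃ hw₄ h h₄

/-- A new point can always be joined to `m` by `p₂` and to all other points of a finite set by
`p₁`. -/
theorem IsPrioritised.isType_single [DecidableEq M] (H : IsPrioritised ok p₁ p₂ p₃) (m : M) :
    IsType ok col B (fun b => if b = m then p₂ else p₁) := by
  intro b _ b' _ hne
  simp only
  split_ifs with h h' h'
  · exact absurd (h.trans h'.symm) hne
  · exact H.swap₁₂ _ _ _ (H.free₂ _)
  · exact H.free₂ _
  · exact H.free₁ _

/-- If an automorphism fixes all realisations of a type over a finite set, then it is trivial: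
a point that it moves can be separated from its image by such a realisation, at first for points
that are joined by `p₁` to the finite set, then for points outside a finite set, then for all
points. -/
theorem IsGenericColouring.movesTypes [FaithfulSMul G M] (H : IsPrioritised ok p₁ p₂ p₃)
    (hc : IsGenericColouring ok col G) {g : G} (hg : g ≠ 1) :
    StationaryIndependence.MovesTypes g M := by
  classical
  intro X y hy
  by_contra! hcon
  have hfix : ∀ z ∉ X, (∀ b ∈ X, col z b = col y b) → g • z = z := by
    intro z hz h
    obtain ⟨s, hs, rfl⟩ := hc.exists_fixer hy hz h
    exact hcon s hs
  -- a fixed point cannot be joined to `m` and to `g • m` by different colours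
  have separate : ∀ m d, g • d = d → d ≠ m → col d m = p₂ → col d (g • m) ≠ p₁ := by
    intro m d hd hdm e e'
    have := hc.smul g d m hdm
    rw [hd, e, e'] at this
    exact H.ne this
  have hstep : ∀ F : Finset M, (∀ d ∉ F, (∀ b ∈ F, col d b = p₁) → g • d = d) → ∀ m ∉ F,
      g • m = m := by
    intro F hF m hm
    by_contra hne
    obtain ⟨d, hd, hd'⟩ := hc.exists_point (insert m (insert (g • m) F)) _ (H.isType_single m)
    simp only [Finset.mem_insert, not_or] at hd
    refine separate m d (hF d hd.2.2 fun b hb => ?_) hd.1 ?_ ?_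
    · rw [hd' b (by simp [hb]), if_neg (ne_of_mem_of_not_mem hb hm)]
    · rw [hd' m (by simp), if_pos rfl]
    · rw [hd' (g • m) (by simp), if_neg hne]
  have h₁ : ∀ m ∉ X ∪ g⁻¹ • X, (∀ b ∈ X ∪ g⁻¹ • X, col m b = p₁) → g • m = m := by
    intro m hm hm'
    by_contra hne
    have hmX : m ∉ X := fun h => hm (Finset.mem_union_left _ h)
    have hgX : g • m ∉ X := fun h => hm (Finset.mem_union_right _ (by
      rw [Finset.mem_inv_smul_finset_iff]; exact h))
    have hcm : ∀ b ∈ X, col b m = p₁ := fun b hb => by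
      rw [hc.symm, hm' b (Finset.mem_union_left _ hb)]
    have hcgm : ∀ b ∈ X, col b (g • m) = p₁ := fun b hb => by
      have hb' : g⁻¹ • b ∈ g⁻¹ • X := Finset.smul_mem_smul_finset hb
      have := hc.smul g m (g⁻¹ • b) fun e => hm (Finset.mem_union_right _ (e ▸ hb'))
      rw [smul_inv_smul, hm' _ (Finset.mem_union_right _ hb')] at this
      rw [hc.symm, this]
    have hu : IsType ok col (insert m (insert (g • m) X))
        (fun b => if b = m then p₂ else if b = g • m then p₁ else col y b) := by
      have h₁ : ∀ b ∈ X, ok (col y b) p₂ (col b m) := fun b hb => by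
        rw [hcm b hb]
        exact H.swap₁₃ (H.free₂ _)
      have h₂ : ∀ b ∈ X, ok (col y b) p₁ (col b (g • m)) := fun b hb => by
        rw [hcgm b hb]
        exact H.swap₁₃ (H.free₁ _)
      intro b hb b' hb' hbb
      simp only [Finset.mem_insert] at hb hb'
      simp only
      split_ifs with e₁ e₂ e₃ e₄ e₅ e₆ e₇ e₈
      · exact absurd (e₁.trans e₂.symm) hbb
      · exact H.swap₁₂ _ _ _ (H.free₂ _)
      · rw [e₁, hc.symm m b']
        exact H.swap₁₂ _ _ _ (h₁ b' ((hb'.resolve_left e₂).resolve_left e₃))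
      · exact H.free₂ _
      · exact H.free₁ _
      · rw [e₄, hc.symm (g • m) b']
        exact H.swap₁₂ _ _ _ (h₂ b' ((hb'.resolve_left e₅).resolve_left e₆))
      · rw [e₇]
        exact h₁ b ((hb.resolve_left e₁).resolve_left e₄)
      · rw [e₈]
        exact h₂ b ((hb.resolve_left e₁).resolve_left e₄)
      · exact hc.isType hy b ((hb.resolve_left e₁).resolve_left e₄) b'
          ((hb'.resolve_left e₇).resolve_left e₈) hbb
    obtain ⟨d, hd, hd'⟩ := hc.exists_point _ _ hu
    simp only [Finset.mem_insert, not_or] at hd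
    refine separate m d (hfix d hd.2.2 fun b hb => ?_) hd.1 ?_ ?_
    · rw [hd' b (by simp [hb]), if_neg (ne_of_mem_of_not_mem hb hmX),
        if_neg (ne_of_mem_of_not_mem hb hgX)]
    · rw [hd' m (by simp), if_pos rfl]
    · rw [hd' (g • m) (by simp), if_neg hne, if_pos rfl]
  have h₂ := hstep _ h₁
  refine hg (FaithfulSMul.eq_of_smul_eq_smul fun m : M => ?_)
  rw [one_smul]
  by_contra hne
  obtain ⟨d, hd, hd'⟩ := hc.exists_point (insert m (insert (g • m) (X ∪ g⁻¹ • X))) _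
    (H.isType_single m)
  rw [Finset.mem_insert, not_or, Finset.mem_insert, not_or] at hd
  refine separate m d (h₂ d hd.2.2) hd.1 ?_ ?_
  · rw [hd' m (by simp), if_pos rfl]
  · rw [hd' (g • m) (by simp), if_neg hne]

/-- The automorphism group of a countable generic structure with a prioritised amalgamation is
simple. -/
theorem IsGenericColouring.isSimpleGroup [Countable M] [FaithfulSMul G M]
    (H : IsPrioritised ok p₁ p₂ p₃) (hc : IsGenericColouring ok col G) (hG : IsClosedAction G M) :
    IsSimpleGroup G where
  exists_pair_ne := by
    obtain ⟨x, hx, -⟩ := hc.exists_point ∅ (fun _ => p₁) (by simp [IsType])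
    obtain ⟨z, hz, -⟩ := hc.exists_point {x} (fun _ => p₁) fun b hb b' hb' h =>
      absurd ((Finset.mem_singleton.1 hb).trans (Finset.mem_singleton.1 hb').symm) h
    obtain ⟨g, -, hg⟩ := hc.exists_fixer (B := ∅) hx (z := z) (by simp) (by simp)
    exact ⟨g, 1, fun e => hz (by rw [Finset.mem_singleton, ← hg, e, one_smul])⟩
  eq_bot_or_eq_top_of_normal N hN := by
    classical
    refine or_iff_not_imp_left.2 fun h => ?_
    obtain ⟨⟨g, hgN⟩, hg⟩ := N.ne_bot_iff_exists_ne_one.1 h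
    exact (hc.stationaryIndependence H).eq_top_of_movesTypes hG N hgN
      (hc.movesTypes H fun e => hg (Subtype.ext e))

end Colours

/-! ### The triangle conditions for the sets in the list -/

/-- The triangle with edge colours `a`, `b`, `c` is not among the forbidden triangles `S`, in
whatever order its colours are listed there. -/
def Allowed {C : Type} (S : Set (C × C × C)) (a b c : C) : Prop :=
  ((a, b, c) ∉ S ∧ (a, c, b) ∉ S) ∧ ((b, a, c) ∉ S ∧ (b, c, a) ∉ S) ∧
    (c, a, b) ∉ S ∧ (c, b, a) ∉ S

instance {C : Type} (S : Set (C × C × C)) [DecidablePred (· ∈ S)] (a b c : C) :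
    Decidable (Allowed S a b c) :=
  inferInstanceAs (Decidable (((a, b, c) ∉ S ∧ (a, c, b) ∉ S) ∧
    ((b, a, c) ∉ S ∧ (b, c, a) ∉ S) ∧ (c, a, b) ∉ S ∧ (c, b, a) ∉ S))

instance : DecidableEq Colour₃ := fun a b => by
  cases a <;> cases b <;> first | exact isTrue rfl | exact isFalse (fun h => nomatch h)

instance : DecidableEq Colour₄ := fun a b => by
  cases a <;> cases b <;> first | exact isTrue rfl | exact isFalse (fun h => nomatch h)

instance : Fintype Colour₃ := ⟨{.R, .G, .X}, fun x => by cases x <;> decide⟩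

instance : Fintype Colour₄ := ⟨{.R, .G, .X, .Y}, fun x => by cases x <;> decide⟩

instance {C : Type*} (ok : C → C → C → Prop) [DecidableEq C] [Fintype C]
    [∀ a b c, Decidable (ok a b c)] (a c a' c' : C) : Decidable (Compatible ok a c a' c') :=
  inferInstanceAs (Decidable ((a = a' ∧ c = c') ∨ ∃ d, ok a a' d ∧ ok c c' d))

set_option synthInstance.maxHeartbeats 400000 in
set_option synthInstance.maxSize 1000 in
instance {C : Type*} (ok : C → C → C → Prop) [DecidableEq C] [Fintype C]
    [∀ a b c, Decidable (ok a b c)] (p₁ p₂ p₃ : C) : Decidable (IsPrioritised ok p₁ p₂ p₃) :=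
  -- each hypothesis comes as early as possible, so that few cases reach the inner quantifiers
  @decidable_of_iff _
    (((∀ a b c, ok a b c → ok b a c) ∧ (∀ a b c, ok a b c → ok a c b) ∧ p₁ ≠ p₂ ∧
      (∀ c, ok p₁ p₁ c) ∧ ∀ c, ok p₁ p₂ c) ∧
    ((∀ a c, ¬ ok a c p₁ → ∀ a' c', ¬ ok a' c' p₂ → Compatible ok a c a' c' →
      ¬ ok a c p₂ ∨ ¬ ok a' c' p₁) ∧
    (∀ a c, ¬ ok a c p₁ → ¬ ok a c p₂ → ∀ a' c', Compatible ok a c a' c' → ok a' c' p₃) ∧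
    ∀ a c, ¬ ok a c p₁ → ¬ ok a c p₂ → a ≠ p₁ ∧ a ≠ p₂ ∧ a ≠ p₃) ∧
    ((p₂ ≠ p₃ → ∀ a c, ¬ ok a c p₁ → ok a c p₂ → ∀ d e, ok c d e → ¬ ok p₂ e p₂ → ¬ ok a d p₂) ∧
    (∀ a c, ¬ ok a c p₁ → ¬ ok a c p₂ → ∀ d e, ok c d e → ¬ ok p₃ e p₁ → ¬ ok a d p₁) ∧
    ∀ a c, ¬ ok a c p₁ → ¬ ok a c p₂ → ∀ d e, ok c d e → ¬ ok p₃ e p₂ → ¬ ok a d p₂))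
    ⟨fun ⟨⟨h₁, h₂, h₃, h₄, h₅⟩, ⟨h₆, h₇, h₈⟩, h₉, h₁₀, h₁₁⟩ => ⟨h₁, h₂, h₃, h₄, h₅,
      fun a c a' c' h => h₆ a c h a' c', fun a c a' c' h h' => h₇ a c h h' a' c', h₈,
      fun hp a c d e h h' => h₉ hp a c h h' d e, fun a c d e h h' => h₁₀ a c h h' d e,
      fun a c d e h h' => h₁₁ a c h h' d e⟩,
    fun H => ⟨⟨H.swap₁₂, H.swap₂₃, H.ne, H.free₁, H.free₂⟩,
      ⟨fun a c h a' c' => H.double a c a' c' h, fun a c h h' a' c' => H.not_blocked a c a' c' h h',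
        H.double_ne⟩, fun hp a c h h' d e => H.trans₂ hp a c d e h h',
      fun a c h h' d e => H.trans₃₁ a c d e h h', fun a c h h' d e => H.trans₃₂ a c d e h h'⟩⟩
    inferInstance

open Colour₃ in
theorem exists_isPrioritised_of_mem_cherlinList₃ :
    ∀ S ∈ cherlinList₃, ∃ p₁ p₂ p₃, IsPrioritised (Allowed S) p₁ p₂ p₃ := by
  simp only [cherlinList₃, List.forall_mem_cons]
  exact ⟨⟨R, G, G, by decide +kernel⟩, fun _ h => absurd h List.not_mem_nil⟩

open Colour₄ in
/-- The first 25 sets use the colours `R` and `G` only; in the last two, `RRX` is forbidden. -/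
theorem exists_isPrioritised_of_mem_cherlinList₄ :
    ∀ S ∈ cherlinList₄, ∃ p₁ p₂ p₃, IsPrioritised (Allowed S) p₁ p₂ p₃ := by
  simp only [cherlinList₄, List.forall_mem_cons]
  iterate 25 refine ⟨⟨R, G, G, by decide +kernel⟩, ?_⟩
  exact ⟨⟨G, R, Y, by decide +kernel⟩, ⟨G, R, R, by decide +kernel⟩,
    fun _ h => absurd h List.not_mem_nil⟩

/-! ### Existence of a generic colouring -/

section Existence

variable {C : Type*} {ok : C → C → C → Prop} {p₁ p₂ p₃ : C}

/-- The colouring of `ℕ` in which `r n m` is the colour of the edge from `n` to `m < n`. -/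
def rowColouring (r : ℕ → ℕ → C) (x y : ℕ) : C := r (max x y) (min x y)

theorem rowColouring_of_lt (r : ℕ → ℕ → C) {x y : ℕ} (h : x < y) : rowColouring r x y = r y x := by
  rw [rowColouring, max_eq_right h.le, min_eq_left h.le]

theorem rowColouring_comm (r : ℕ → ℕ → C) (x y : ℕ) : rowColouring r x y = rowColouring r y x := by
  rw [rowColouring, rowColouring, max_comm, min_comm]

theorem IsPrioritised.isColouring_rowColouring (H : IsPrioritised ok p₁ p₂ p₃) {r : ℕ → ℕ → C}
    (h : ∀ n, IsType ok (rowColouring r) (Finset.range n) (r n)) :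
    IsColouring ok (rowColouring r) where
  symm := rowColouring_comm r
  triangle x y z hxy hxz hyz := by
    have key : ∀ a b c, a < b → b < c →
        ok (rowColouring r a b) (rowColouring r a c) (rowColouring r b c) := by
      intro a b c hab hbc
      rw [rowColouring_of_lt r (hab.trans hbc), rowColouring_of_lt r hbc]
      exact H.rotate (H.rotate (h c a (by simp; omega) b (by simp; omega) hab.ne))
    have c := rowColouring_comm r
    rcases hxy.lt_or_gt with h₁ | h₁ <;> rcases hxz.lt_or_gt with h₂ | h₂ <;>
      rcases hyz.lt_or_gt with h₃ | h₃
    · exact key x y z h₁ h₃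
    · rw [c y z]
      exact H.swap₁₂ _ _ _ (key x z y h₂ h₃)
    · omega
    · rw [c x z, c y z]
      exact H.rotate (H.rotate (key z x y h₂ h₁))
    · rw [c x y]
      exact H.swap₂₃ _ _ _ (key y x z h₁ h₂)
    · omega
    · rw [c x y, c x z]
      exact H.rotate (key y z x h₃ h₂)
    · rw [c x y, c x z, c y z]
      exact H.swap₁₃ (key z y x h₃ h₁)

open Classical in
/-- The colours from the point `n` to the smaller points, defined by recursion on `n`: if
`task n = (B, u)` is a type, then `n` realises it and is joined to the points outside `B` by the
preferred colours.  Edges that have not been coloured yet count as coloured by `p₁`, which creates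
no forbidden triangles. -/
noncomputable def genericRow (ok : C → C → C → Prop) (p₁ p₂ p₃ : C)
    (task : ℕ → Finset ℕ × (ℕ → C)) (n : ℕ) : ℕ → C :=
  let col := rowColouring fun m =>
    if _h : m < n then genericRow ok p₁ p₂ p₃ task m else fun _ => p₁
  if IsType ok col (task n).1 (task n).2 then
    fun d => if d ∈ (task n).1 then (task n).2 d else
      freeColour ok p₁ p₂ p₃ (task n).1 (task n).2 (col d)
  else fun _ => p₁

theorem IsPrioritised.isType_genericRow (H : IsPrioritised ok p₁ p₂ p₃)
    (task : ℕ → Finset ℕ × (ℕ → C)) (n : ℕ) :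
    IsType ok (rowColouring (genericRow ok p₁ p₂ p₃ task)) (Finset.range n)
      (genericRow ok p₁ p₂ p₃ task n) := by
  classical
  induction n using Nat.strong_induction_on with
  | _ n ih =>
  set r := genericRow ok p₁ p₂ p₃ task with hr
  set s : ℕ → ℕ → C := fun m => if _h : m < n then r m else fun _ => p₁ with hs
  have hsr : ∀ x < n, ∀ y < n, rowColouring s x y = rowColouring r x y := by
    intro x hx y hy
    rw [rowColouring, rowColouring, hs]
    simp only
    rw [dif_pos (max_lt hx hy)]
  have hcol : IsColouring ok (rowColouring s) := by
    refine H.isColouring_rowColouring fun m => ?_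
    by_cases hm : m < n
    · have hsm : s m = r m := dif_pos hm
      rw [hsm]
      intro b hb b' hb' hbb
      rw [hsr b ((Finset.mem_range.1 hb).trans hm) b' ((Finset.mem_range.1 hb').trans hm)]
      exact ih m hm b hb b' hb' hbb
    · have hsm : s m = fun _ => p₁ := dif_neg hm
      rw [hsm]
      exact fun _ _ _ _ _ => H.free₁ _
  intro b hb b' hb' hbb
  rw [← hsr b (Finset.mem_range.1 hb) b' (Finset.mem_range.1 hb'), hr, genericRow]
  simp only [← hr, ← hs]
  split_ifs with h
  · exact H.isType_extend hcol h (Finset.range n) b hb b' hb' hbb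
  · exact H.free₁ _

/-- There is a colouring of a countable set without forbidden triangles in which all types over
finite sets are realised. -/
theorem IsPrioritised.exists_isColouring_nat [Countable C] (H : IsPrioritised ok p₁ p₂ p₃) :
    ∃ col : ℕ → ℕ → C, IsColouring ok col ∧ ∀ (B : Finset ℕ) (u : ℕ → C), IsType ok col B u →
      ∃ z, z ∉ B ∧ ∀ b ∈ B, col z b = u b := by
  classical
  obtain ⟨e, he⟩ := exists_surjective_nat (Finset ℕ × List C)
  -- each task is given at infinitely many stages
  let task : ℕ → Finset ℕ × (ℕ → C) := fun n =>
    ((e n.unpair.1).1, fun b => (e n.unpair.1).2.getD b p₁)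
  refine ⟨rowColouring (genericRow ok p₁ p₂ p₃ task),
    H.isColouring_rowColouring (H.isType_genericRow task), fun B u hu => ?_⟩
  obtain ⟨k, hk⟩ := he (B, (List.range (B.sup id + 1)).map u)
  set n := Nat.pair k (B.sup id + 1) with hn
  have hlt : ∀ b ∈ B, b < n := fun b hb =>
    ((Finset.le_sup (f := id) hb).trans_lt (Nat.lt_succ_self _)).trans_le (Nat.right_le_pair _ _)
  have ht₁ : (task n).1 = B := by simp [task, hn, hk]
  have ht₂ : ∀ b ∈ B, (task n).2 b = u b := fun b hb => by
    have : b < B.sup id + 1 := (Finset.le_sup (f := id) hb).trans_lt (Nat.lt_succ_self _)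
    simp [task, hn, hk, this]
  refine ⟨n, fun h => (hlt n h).ne rfl, fun b hb => ?_⟩
  rw [rowColouring_comm, rowColouring_of_lt _ (hlt b hb), genericRow]
  simp only [ht₁]
  rw [if_pos, if_pos hb, ht₂ b hb]
  intro x hx y hy hxy
  have := hu x hx y hy hxy
  rw [ht₂ x hx, ht₂ y hy]
  rw [rowColouring] at this ⊢
  rwa [dif_pos (max_lt (hlt x hx) (hlt y hy))]

end Existence

/-! ### Complete structures as coloured sets -/

section Structures

variable {C : Type}

/-- The edge colouring `col` describes the structure `A`. -/
def IsColouringOf {C : Type} (A : Type u) [(colourLanguage C).Structure A]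
    (col : A → A → C) : Prop :=
  ∀ d x y, HasColour A d x y ↔ x ≠ y ∧ col x y = d

/-- The structure described by an edge colouring. -/
@[reducible] def colourStructure {A : Type u} (col : A → A → C) :
    (colourLanguage C).Structure A where
  funMap f := nomatch f
  RelMap
    | .edge d => fun x => x 0 ≠ x 1 ∧ col (x 0) (x 1) = d

theorem isColouringOf_colourStructure {A : Type u} (col : A → A → C) :
    @IsColouringOf C A (colourStructure col) col :=
  fun _ _ _ => Iff.rfl

section Embeddings

variable {A B : Type*} [(colourLanguage C).Structure A] [(colourLanguage C).Structure B]

/-- An injective map that respects colours is an embedding. -/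
def embeddingOfHasColour (f : A → B) (hf : Function.Injective f)
    (h : ∀ (d : C) x y, HasColour B d (f x) (f y) ↔ HasColour A d x y) :
    A ↪[colourLanguage C] B where
  toFun := f
  inj' := hf
  map_fun' g := nomatch g
  map_rel' := by
    rintro n ⟨d⟩ x
    have key : ∀ x : Fin 2 → A, Structure.RelMap (colourSymbol d) (f ∘ x) ↔
        Structure.RelMap (colourSymbol d) x := by
      intro x
      have e₁ : x = ![x 0, x 1] := by
        ext i
        fin_cases i <;> rfl
      have e₂ : f ∘ x = ![f (x 0), f (x 1)] := by
        ext i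
        fin_cases i <;> rfl
      rw [e₂, e₁]
      exact h d (x 0) (x 1)
    exact key x

theorem hasColour_iff_of_embedding (f : A ↪[colourLanguage C] B) (d : C) (x y : A) :
    HasColour B d (f x) (f y) ↔ HasColour A d x y := by
  have := f.map_rel (colourSymbol d) ![x, y]
  rw [HasColour, HasColour, ← this]
  have e : f ∘ ![x, y] = ![f x, f y] := by
    ext i
    fin_cases i <;> rfl
  rw [e]

/-- A bijection that respects colours is an isomorphism. -/
def equivOfHasColour (f : A ≃ B)
    (h : ∀ (d : C) x y, HasColour B d (f x) (f y) ↔ HasColour A d x y) :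
    A ≃[colourLanguage C] B where
  toEquiv := f
  map_fun' g := nomatch g
  map_rel' r x := (embeddingOfHasColour f f.injective h).map_rel r x

end Embeddings

variable {S : Set (C × C × C)} {A : Type u} [(colourLanguage C).Structure A] {col : A → A → C}

theorem IsCompleteStructure.exists_isColouringOf [Nonempty C] (h : IsCompleteStructure C A) :
    ∃ col : A → A → C, IsColouringOf A col := by
  classical
  choose c hc using h.existsUnique_colour
  refine ⟨fun x y => if e : x = y then Classical.arbitrary C else c x y e, fun d x y => ?_⟩
  by_cases e : x = y
  · subst e
    simp [h.irrefl]
  · simp only [dif_neg e]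
    exact ⟨fun hd => ⟨e, ((hc x y e).2 d hd).symm⟩, fun hd => hd.2 ▸ (hc x y e).1⟩

theorem IsColouringOf.colour (hA : IsColouringOf A col) {x y : A} (h : x ≠ y) :
    HasColour A (col x y) x y :=
  (hA _ _ _).2 ⟨h, rfl⟩

theorem hasColour_triangle {t : C × C × C} {d : C} {x y : Triangle t} :
    HasColour (Triangle t) d x y ↔ (d = t.1 ∧ s(x, y) = s(.v₀, .v₁)) ∨
      (d = t.2.1 ∧ s(x, y) = s(.v₁, .v₂)) ∨ (d = t.2.2 ∧ s(x, y) = s(.v₀, .v₂)) :=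
  Iff.rfl

/-- A triangle embeds in `A` when the three edges between some three points have its colours. -/
theorem IsColouringOf.nonempty_triangle_embedding (hA : IsColouringOf A col)
    (hs : ∀ x y, col x y = col y x) (t : C × C × C) :
    Nonempty (Triangle t ↪[colourLanguage C] A) ↔
      ∃ x y z, x ≠ y ∧ x ≠ z ∧ y ≠ z ∧ t = (col x y, col y z, col x z) := by
  obtain ⟨a, b, c⟩ := t
  constructor
  · rintro ⟨f⟩
    have h := fun d x y => (hasColour_iff_of_embedding f d x y).trans hasColour_triangle
    have h₁ := (hA _ _ _).1 ((h a .v₀ .v₁).2 (by simp))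
    have h₂ := (hA _ _ _).1 ((h b .v₁ .v₂).2 (by simp))
    have h₃ := (hA _ _ _).1 ((h c .v₀ .v₂).2 (by simp))
    exact ⟨f .v₀, f .v₁, f .v₂, h₁.1, h₃.1, h₂.1, by rw [h₁.2, h₂.2, h₃.2]⟩
  · rintro ⟨x, y, z, hxy, hxz, hyz, h⟩
    simp only [Prod.mk.injEq] at h
    obtain ⟨rfl, rfl, rfl⟩ := h
    refine ⟨embeddingOfHasColour (fun v => match v with
      | .v₀ => x
      | .v₁ => y
      | .v₂ => z) ?_ ?_⟩
    · intro v w h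
      cases v <;> cases w <;> simp_all
    · intro d v w
      rw [hasColour_triangle, hA]
      cases v <;> cases w <;> simp [hxy, hxz, hyz, hxy.symm, hxz.symm, hyz.symm, hs y x, hs z x,
        hs z y, eq_comm]

theorem IsColouringOf.isColouring (hA : IsColouringOf A col) (h : IsCompleteStructure C A)
    (hS : ∀ t ∈ S, IsEmpty (Triangle t ↪[colourLanguage C] A)) : IsColouring (Allowed S) col := by
  have hs : ∀ x y, col x y = col y x := fun x y => by
    by_cases e : x = y
    · rw [e]
    · exact ((hA _ _ _).1 (h.symm _ _ _ (hA.colour (Ne.symm e)))).2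
  have key : ∀ x y z, x ≠ y → x ≠ z → y ≠ z → (col x y, col y z, col x z) ∉ S :=
    fun x y z hxy hxz hyz ht => not_nonempty_iff.2 (hS _ ht)
      ((hA.nonempty_triangle_embedding hs _).2 ⟨x, y, z, hxy, hxz, hyz, rfl⟩)
  refine ⟨hs, fun x y z hxy hxz hyz => ⟨⟨?_, ?_⟩, ⟨?_, ?_⟩, ?_, ?_⟩⟩
  · simpa only [hs y x] using key y x z hxy.symm hyz hxz
  · exact key x y z hxy hxz hyz
  · simpa only [hs z x, hs z y] using key z x y hxz.symm hyz.symm hxy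
  · simpa only [hs z y] using key x z y hxz hxy hyz.symm
  · simpa only [hs z y, hs y x, hs z x] using key z y x hyz.symm hxz.symm hxy.symm
  · simpa only [hs z x, hs y x] using key y z x hyz hxy.symm hxz.symm

theorem IsColouringOf.isCompleteStructure (hA : IsColouringOf A col)
    (hs : ∀ x y, col x y = col y x) : IsCompleteStructure C A where
  symm d x y h := (hA _ _ _).2 ⟨((hA _ _ _).1 h).1.symm, by rw [hs, ((hA _ _ _).1 h).2]⟩
  irrefl d x h := ((hA _ _ _).1 h).1 rfl
  existsUnique_colour x y h := ⟨_, hA.colour h, fun d hd => ((hA _ _ _).1 hd).2.symm⟩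

theorem IsColouringOf.isEmpty_triangle_embedding (hA : IsColouringOf A col)
    (h : IsColouring (Allowed S) col) {t : C × C × C} (ht : t ∈ S) :
    IsEmpty (Triangle t ↪[colourLanguage C] A) := by
  rw [← not_nonempty_iff, hA.nonempty_triangle_embedding h.symm]
  rintro ⟨x, y, z, hxy, hxz, hyz, rfl⟩
  exact (h.triangle x y z hxy hxz hyz).1.2 ht

end Structures

/-! ### Generic colourings and Fraïssé limits -/

section PartialIsomorphisms

variable {C A M : Type*} {ok : C → C → C → Prop} {col : M → M → C} {colA : A → A → C}

/-- The map `f` is injective and respects colours on the set `F`. -/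
structure IsPartialIso (colA : A → A → C) (col : M → M → C) (F : Set A) (f : A → M) : Prop where
  injOn : Set.InjOn f F
  colour : ∀ x ∈ F, ∀ y ∈ F, x ≠ y → col (f x) (f y) = colA x y

/-- The extension step of the back-and-forth construction. -/
theorem IsPartialIso.exists_insert [DecidableEq A] (hA : IsColouring ok colA)
    (hc : IsColouring ok col) (hex : ∀ (B : Finset M) (u : M → C), IsType ok col B u →
      ∃ z, z ∉ B ∧ ∀ b ∈ B, col z b = u b)
    {F : Finset A} {f : A → M} (hf : IsPartialIso colA col F f) (a : A) :
    ∃ f' : A → M, IsPartialIso colA col (insert a F : Finset A) f' ∧ ∀ x ∈ F, f' x = f x := by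
  classical
  by_cases ha : a ∈ F
  · exact ⟨f, by rwa [Finset.insert_eq_of_mem ha], fun _ _ => rfl⟩
  have : Nonempty A := ⟨a⟩
  have hinv : ∀ x ∈ F, Function.invFunOn f F (f x) = x := fun x hx =>
    hf.injOn.leftInvOn_invFunOn hx
  obtain ⟨z, hz, hz'⟩ := hex (F.image f) (fun m => colA a (Function.invFunOn f F m)) (by
    intro b hb b' hb' hbb
    obtain ⟨x, hx, rfl⟩ := Finset.mem_image.1 hb
    obtain ⟨y, hy, rfl⟩ := Finset.mem_image.1 hb'
    have hxy : x ≠ y := fun e => hbb (e ▸ rfl)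
    simp only [hinv x hx, hinv y hy]
    rw [hf.colour x hx y hy hxy]
    exact hA.triangle a x y (ne_of_mem_of_not_mem hx ha).symm (ne_of_mem_of_not_mem hy ha).symm hxy)
  have hza : ∀ x ∈ F, z ≠ f x := fun x hx e => hz (e ▸ Finset.mem_image_of_mem f hx)
  have hzc : ∀ x ∈ F, col z (f x) = colA a x := fun x hx => by
    rw [hz' _ (Finset.mem_image_of_mem f hx), hinv x hx]
  have e₁ : Function.update f a z a = z := Function.update_self ..
  have e₂ : ∀ x ∈ F, Function.update f a z x = f x := fun x hx =>
    Function.update_of_ne (ne_of_mem_of_not_mem hx ha) ..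
  refine ⟨Function.update f a z, ⟨?_, ?_⟩, e₂⟩
  · intro x hx y hy h
    rcases Finset.mem_insert.1 hx with hx | hx <;> rcases Finset.mem_insert.1 hy with hy | hy
    · rw [hx, hy]
    · rw [hx, e₁, e₂ y hy] at h
      exact absurd h (hza y hy)
    · rw [hy, e₁, e₂ x hx] at h
      exact absurd h.symm (hza x hx)
    · rw [e₂ x hx, e₂ y hy] at h
      exact hf.injOn hx hy h
  · intro x hx y hy h
    rcases Finset.mem_insert.1 hx with hx | hx <;> rcases Finset.mem_insert.1 hy with hy | hy
    · exact absurd (hx.trans hy.symm) h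
    · rw [hx, e₁, e₂ y hy, hzc y hy]
    · rw [hy, e₁, e₂ x hx, hc.symm, hzc x hx, hA.symm]
    · rw [e₂ x hx, e₂ y hy]
      exact hf.colour x hx y hy h

theorem IsPartialIso.exists_union [DecidableEq A] (hA : IsColouring ok colA)
    (hc : IsColouring ok col) (hex : ∀ (B : Finset M) (u : M → C), IsType ok col B u →
      ∃ z, z ∉ B ∧ ∀ b ∈ B, col z b = u b)
    {F : Finset A} {f : A → M} (hf : IsPartialIso colA col F f) (D : Finset A) :
    ∃ f' : A → M, IsPartialIso colA col (D ∪ F : Finset A) f' ∧ ∀ x ∈ F, f' x = f x := by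
  induction D using Finset.induction_on with
  | empty => exact ⟨f, by rwa [Finset.empty_union], fun _ _ => rfl⟩
  | insert a D _ ih =>
    obtain ⟨f₁, hf₁, h₁⟩ := ih
    obtain ⟨f₂, hf₂, h₂⟩ := hf₁.exists_insert hA hc hex a
    refine ⟨f₂, by rwa [Finset.insert_union], fun x hx => ?_⟩
    rw [h₂ x (Finset.mem_union_right _ hx), h₁ x hx]

/-- A partial isomorphism from a finite structure extends to the whole structure. -/
theorem IsPartialIso.exists_univ [Finite A] (hA : IsColouring ok colA)
    (hc : IsColouring ok col) (hex : ∀ (B : Finset M) (u : M → C), IsType ok col B u →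
      ∃ z, z ∉ B ∧ ∀ b ∈ B, col z b = u b)
    {F : Set A} {f : A → M} (hf : IsPartialIso colA col F f) :
    ∃ f' : A → M, IsPartialIso colA col Set.univ f' ∧ ∀ x ∈ F, f' x = f x := by
  classical
  have := Fintype.ofFinite A
  obtain ⟨f', h, h'⟩ := IsPartialIso.exists_union (F := F.toFinset) hA hc hex (by simpa using hf)
    Finset.univ
  exact ⟨f', by simpa using h, by simpa using h'⟩

end PartialIsomorphisms

section Limits

open FirstOrder.Language

variable {C : Type} {S : Set (C × C × C)}

/-- In a relational language every set is a substructure. -/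
def setSubstructure (C : Type) {M : Type*} [(colourLanguage C).Structure M] (s : Set M) :
    (colourLanguage C).Substructure M :=
  ⟨s, fun f => nomatch f⟩

theorem mem_setSubstructure {M : Type*} [(colourLanguage C).Structure M] {s : Set M} {x : M} :
    x ∈ setSubstructure C s ↔ x ∈ s :=
  Iff.rfl

theorem setSubstructure_fg {M : Type*} [(colourLanguage C).Structure M] (B : Finset M) :
    (setSubstructure C (B : Set M)).FG :=
  Substructure.fg_iff_finite.2 B.finite_toSet

variable {A M : Type u} [(colourLanguage C).Structure A] [(colourLanguage C).Structure M]
  {colA : A → A → C} {col : M → M → C}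

/-- The embedding given by a partial isomorphism that is defined everywhere. -/
def IsPartialIso.toEmbedding (hA : IsColouringOf A colA) (hM : IsColouringOf M col) {f : A → M}
    (hf : IsPartialIso colA col Set.univ f) : A ↪[colourLanguage C] M :=
  embeddingOfHasColour f (Set.injOn_univ.1 hf.injOn) fun d x y => by
    rw [hA, hM]
    refine ⟨fun h => ?_, fun h => ?_⟩
    · have hxy : x ≠ y := fun e => h.1 (e ▸ rfl)
      exact ⟨hxy, by rw [← hf.colour x trivial y trivial hxy, h.2]⟩
    · exact ⟨fun e => h.1 (hf.injOn trivial trivial e),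
        by rw [hf.colour x trivial y trivial h.1, h.2]⟩

theorem isPartialIso_of_embedding (hA : IsColouringOf A colA) (hM : IsColouringOf M col)
    (f : A ↪[colourLanguage C] M) : IsPartialIso colA col Set.univ f where
  injOn := f.injective.injOn
  colour x _ y _ h := ((hM _ _ _).1 ((hasColour_iff_of_embedding f _ x y).2 (hA.colour h))).2

/-- The induced colouring of a substructure. -/
theorem IsColouringOf.comp_embedding (hM : IsColouringOf M col) (f : A ↪[colourLanguage C] M) :
    IsColouringOf A (fun x y => col (f x) (f y)) := fun d x y => by
  rw [← hasColour_iff_of_embedding f, hM, f.injective.ne_iff]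

theorem IsColouring.comp {C A M : Type*} {ok : C → C → C → Prop} {col : M → M → C}
    (hc : IsColouring ok col) {f : A → M} (hf : Function.Injective f) :
    IsColouring ok (fun x y => col (f x) (f y)) where
  symm _ _ := hc.symm _ _
  triangle _ _ _ hxy hxz hyz := hc.triangle _ _ _ (hf.ne hxy) (hf.ne hxz) (hf.ne hyz)

theorem mem_Forbc_of_isColouring {A : CategoryTheory.Bundled.{u} (colourLanguage C).Structure}
    [Finite A] {colA : A → A → C} (hA : IsColouringOf A colA) (h : IsColouring (Allowed S) colA) :
    A ∈ Forbc S :=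
  ⟨inferInstance, hA.isCompleteStructure h.symm, fun _ ht => hA.isEmpty_triangle_embedding h ht⟩

theorem exists_isColouring_of_mem_Forbc [Nonempty C]
    {A : CategoryTheory.Bundled.{u} (colourLanguage C).Structure} (hA : A ∈ Forbc S) :
    ∃ colA : A → A → C, IsColouringOf A colA ∧ IsColouring (Allowed S) colA := by
  obtain ⟨colA, h⟩ := hA.2.1.exists_isColouringOf
  exact ⟨colA, h, h.isColouring hA.2.1 hA.2.2⟩

/-- A countable coloured set that realises all types over finite sets is a Fraïssé limit. -/
theorem isFraisseLimit_of_exists_point [Nonempty C] [Countable M] (hM : IsColouringOf M col)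
    (hc : IsColouring (Allowed S) col) (hex : ∀ (B : Finset M) (u : M → C),
      IsType (Allowed S) col B u → ∃ z, z ∉ B ∧ ∀ b ∈ B, col z b = u b) :
    IsFraisseLimit (Forbc S) M where
  age := by
    ext N
    constructor
    · rintro ⟨hN, ⟨f⟩⟩
      have : Finite N := Structure.fg_iff_finite.1 hN
      exact mem_Forbc_of_isColouring (hM.comp_embedding f) (hc.comp f.injective)
    · intro hN
      obtain ⟨colN, h, h'⟩ := exists_isColouring_of_mem_Forbc hN
      have : Finite N := hN.1
      obtain ⟨z, -⟩ := hex ∅ (fun _ => Classical.arbitrary C) (by simp [IsType])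
      obtain ⟨f, hf, -⟩ := IsPartialIso.exists_univ (F := ∅) (f := fun _ => z) h' hc hex
        ⟨by simp, by simp⟩
      exact ⟨Structure.fg_iff_finite.2 this, ⟨hf.toEmbedding h hM⟩⟩
  ultrahomogeneous := by
    classical
    rw [isUltrahomogeneous_iff_IsExtensionPair Structure.cg_of_countable,
      isExtensionPair_iff_exists_embedding_closure_singleton_sup]
    intro D hD f m
    set T := Substructure.closure (colourLanguage C) {m} ⊔ D with hT
    have hfin : Finite T :=
      Substructure.fg_iff_finite.1 ((Substructure.fg_closure_singleton m).sup hD)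
    set i : D ↪[colourLanguage C] T := Substructure.inclusion le_sup_right with hi
    have hTc := hM.comp_embedding T.subtype
    have hDc := hTc.comp_embedding i
    have hf := isPartialIso_of_embedding hDc hM f
    have hex' : ∀ x : D, Function.extend i f (fun t => (t : M)) (i x) = f x :=
      i.injective.extend_apply _ _
    obtain ⟨g, hg, hg'⟩ := IsPartialIso.exists_univ (F := Set.range i)
      (f := Function.extend i f (fun t => (t : M))) (hc.comp T.subtype.injective) hc hex (by
        constructor
        · rintro _ ⟨x, rfl⟩ _ ⟨y, rfl⟩ h
          rw [hex', hex'] at h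
          rw [f.injective h]
        · rintro _ ⟨x, rfl⟩ _ ⟨y, rfl⟩ h
          rw [hex', hex']
          exact hf.colour x trivial y trivial fun e => h (e ▸ rfl))
    refine ⟨hg.toEmbedding hTc hM, ?_⟩
    ext x
    exact ((hg' (i x) ⟨x, rfl⟩).trans (hex' x)).symm

/-- Existence of the Fraïssé limit. -/
theorem exists_isFraisseLimit [Countable C] {p₁ p₂ p₃ : C}
    (H : IsPrioritised (Allowed S) p₁ p₂ p₃) :
    ∃ (M : Type u) (_ : (colourLanguage C).Structure M) (_ : Countable M),
      IsFraisseLimit (Forbc S) M := by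
  classical
  obtain ⟨col, hc, hex⟩ := H.exists_isColouring_nat
  have : Nonempty C := ⟨p₁⟩
  let col' : ULift.{u} ℕ → ULift.{u} ℕ → C := fun x y => col x.down y.down
  refine ⟨ULift.{u} ℕ, colourStructure col', inferInstance, ?_⟩
  let _ := colourStructure col'
  refine isFraisseLimit_of_exists_point (isColouringOf_colourStructure col')
    (hc.comp ULift.down_injective) fun B u hu => ?_
  obtain ⟨z, hz, hz'⟩ := hex (B.image ULift.down) (fun n => u ⟨n⟩) (by
    intro x hx y hy h
    obtain ⟨b, hb, rfl⟩ := Finset.mem_image.1 hx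
    obtain ⟨b', hb', rfl⟩ := Finset.mem_image.1 hy
    exact hu _ hb _ hb' fun e => h (e ▸ rfl))
  exact ⟨⟨z⟩, fun h => hz (Finset.mem_image_of_mem _ h),
    fun b hb => hz' _ (Finset.mem_image_of_mem _ hb)⟩

end Limits

/-! ### The automorphism group of a Fraïssé limit -/

section AutomorphismGroup

open FirstOrder.Language

variable {C : Type} {S : Set (C × C × C)} {M : Type u} [(colourLanguage C).Structure M]
  {col : M → M → C}

/-- Automorphisms act on the points of a structure. -/
instance automorphismAction (L : Language) (M : Type u) [L.Structure M] :
    MulAction (M ≃[L] M) M where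
  smul g x := g x
  one_smul _ := rfl
  mul_smul _ _ _ := rfl

instance (L : Language) (M : Type u) [L.Structure M] : FaithfulSMul (M ≃[L] M) M where
  eq_of_smul_eq_smul h := Language.Equiv.ext h

theorem hasColour_smul (g : M ≃[colourLanguage C] M) (d : C) (x y : M) :
    HasColour M d (g • x) (g • y) ↔ HasColour M d x y :=
  hasColour_iff_of_embedding g.toEmbedding d x y

/-- The automorphism group is closed under pointwise limits of sequences that converge together
with their inverses. -/
theorem isClosedAction_automorphismGroup : IsClosedAction (M ≃[colourLanguage C] M) M := by
  intro h h₁ h₂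
  choose N hN using h₁
  choose N' hN' using h₂
  let f : M ≃ M :=
    { toFun := fun m => h (N m) • m
      invFun := fun m => (h (N' m))⁻¹ • m
      left_inv := fun m => by
        beta_reduce
        set t := max (N m) (N' (h (N m) • m))
        rw [← hN' _ t (le_max_right _ _), ← hN m t (le_max_left _ _), inv_smul_smul]
      right_inv := fun m => by
        beta_reduce
        set t := max (N' m) (N ((h (N' m))⁻¹ • m))
        rw [← hN _ t (le_max_right _ _), ← hN' m t (le_max_left _ _), smul_inv_smul] }
  refine ⟨equivOfHasColour f fun d x y => ?_, fun m => ⟨N m, fun t ht => hN m t ht⟩⟩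
  change HasColour M d (h (N x) • x) (h (N y) • y) ↔ _
  rw [← hN x _ (le_max_left (N x) (N y)), ← hN y _ (le_max_right (N x) (N y)), hasColour_smul]

/-- A Fraïssé limit is described by a colouring without forbidden triangles. -/
theorem exists_isColouring_of_isFraisseLimit [Nonempty C] [Countable M]
    (h : IsFraisseLimit (Forbc S) M) :
    ∃ col : M → M → C, IsColouringOf M col ∧ IsColouring (Allowed S) col := by
  classical
  have hmem : ∀ B : Finset M, CategoryTheory.Bundled.mk (setSubstructure C (B : Set M)) ∈ Forbc S :=
    fun B => h.age ▸ age.fg_substructure (setSubstructure_fg B)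
  have hM : IsCompleteStructure C M := by
    have key : ∀ x y, ∃ (B : Finset M) (x' y' : setSubstructure C (B : Set M)),
        (x' : M) = x ∧ (y' : M) = y := fun x y =>
      ⟨{x, y}, ⟨x, by simp [mem_setSubstructure]⟩, ⟨y, by simp [mem_setSubstructure]⟩, rfl, rfl⟩
    have hcol : ∀ (B : Finset M) (d : C) (x y : setSubstructure C (B : Set M)),
        HasColour M d (x : M) (y : M) ↔ HasColour (setSubstructure C (B : Set M)) d x y :=
      fun B => hasColour_iff_of_embedding (setSubstructure C (B : Set M)).subtype
    refine ⟨fun d x y hd => ?_, fun d x hd => ?_, fun x y hxy => ?_⟩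
    · obtain ⟨B, x, y, rfl, rfl⟩ := key x y
      exact (hcol B _ _ _).2 ((hmem B).2.1.symm _ _ _ ((hcol B _ _ _).1 hd))
    · obtain ⟨B, x, -, rfl, -⟩ := key x x
      exact (hmem B).2.1.irrefl _ _ ((hcol B _ _ _).1 hd)
    · obtain ⟨B, x, y, rfl, rfl⟩ := key x y
      simp only [hcol]
      exact (hmem B).2.1.existsUnique_colour x y fun e => hxy (e ▸ rfl)
  obtain ⟨col, hcol⟩ := hM.exists_isColouringOf
  refine ⟨col, hcol, hcol.isColouring hM fun t ht => ⟨fun f => ?_⟩⟩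
  have : Finite (Triangle t) := Finite.of_surjective (fun i : Fin 3 => match i with
    | 0 => .v₀
    | 1 => .v₁
    | 2 => .v₂) (fun v => by
      cases v
      exacts [⟨0, rfl⟩, ⟨1, rfl⟩, ⟨2, rfl⟩])
  have hr : CategoryTheory.Bundled.mk f.toHom.range ∈ Forbc S :=
    h.age ▸ age.fg_substructure ((Structure.FG.range (Structure.fg_iff_finite.2 this) f.toHom))
  exact (hr.2.2 t ht).false f.equivRange.toEmbedding

/-- A Fraïssé limit is generic for its automorphism group. -/
theorem isGenericColouring_of_isFraisseLimit [Nonempty C] [Countable M]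
    (h : IsFraisseLimit (Forbc S) M) (hM : IsColouringOf M col)
    (hc : IsColouring (Allowed S) col)
    {p₁ p₂ p₃ : C} (H : IsPrioritised (Allowed S) p₁ p₂ p₃) :
    IsGenericColouring (Allowed S) col (M ≃[colourLanguage C] M) where
  toIsColouring := hc
  smul g x y hxy :=
    ((hM _ _ _).1 ((hasColour_smul g _ _ _).2 (hM.colour hxy))).2
  exists_point B u hu := by
    classical
    let colA : Option B → Option B → C := fun x y =>
      x.elim (y.elim (Classical.arbitrary C) fun b => u b)
        fun b => y.elim (u b) fun b' => col b b'
    let _ := colourStructure colA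
    let _ := colourStructure (fun x y : B => col x y)
    have hA := isColouringOf_colourStructure colA
    have hB := isColouringOf_colourStructure (fun x y : B => col x y)
    have hcA : IsColouring (Allowed S) colA := by
      constructor
      · rintro (_ | x) (_ | y)
        exacts [rfl, rfl, rfl, hc.symm _ _]
      · rintro (_ | x) (_ | y) (_ | z) hxy hxz hyz
        · exact absurd rfl hxy
        · exact absurd rfl hxy
        · exact absurd rfl hxz
        · exact hu y y.2 z z.2 fun e => hyz (congrArg some (Subtype.ext e))
        · exact absurd rfl hyz
        · exact H.swap₂₃ _ _ _ (hu x x.2 z z.2 fun e => hxz (congrArg some (Subtype.ext e)))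
        · exact H.rotate (H.rotate (hu x x.2 y y.2 fun e => hxy (congrArg some (Subtype.ext e))))
        · exact hc.triangle x y z (fun e => hxy (congrArg some (Subtype.ext e)))
            (fun e => hxz (congrArg some (Subtype.ext e)))
            fun e => hyz (congrArg some (Subtype.ext e))
    have hmem : CategoryTheory.Bundled.mk (Option B) ∈ Forbc S := mem_Forbc_of_isColouring hA hcA
    rw [← h.age] at hmem
    have : Nonempty (Option B ↪[colourLanguage C] M) := hmem.2
    let i : B ↪[colourLanguage C] Option B := IsPartialIso.toEmbedding hB hA (f := some)
      ⟨fun x _ y _ h => Option.some_injective _ h, fun x _ y _ _ => rfl⟩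
    let j : B ↪[colourLanguage C] M := IsPartialIso.toEmbedding hB hM (f := Subtype.val)
      ⟨fun x _ y _ h => Subtype.ext h, fun x _ y _ _ => rfl⟩
    obtain ⟨f, hf⟩ := h.ultrahomogeneous.extend_embedding
      (Structure.fg_iff_finite.2 inferInstance) j i
    have hfB : ∀ b : B, f (some b) = b := fun b => (DFunLike.congr_fun hf b).symm
    refine ⟨f none, fun hb => ?_, fun b hb => ?_⟩
    · have := f.injective (hfB ⟨_, hb⟩)
      exact Option.some_ne_none _ this
    · have := (isPartialIso_of_embedding hA hM f).colour none trivial (some ⟨b, hb⟩) trivial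
        (Option.some_ne_none _).symm
      rwa [hfB] at this
  exists_extension B f hf hf' := by
    let T := setSubstructure C (B : Set M)
    obtain ⟨g, hg⟩ := h.ultrahomogeneous T (setSubstructure_fg B)
      (IsPartialIso.toEmbedding (hM.comp_embedding T.subtype) hM (f := fun x => f x)
        ⟨fun x _ y _ h => Subtype.ext (hf x.2 y.2 h),
          fun x _ y _ h => hf' x x.2 y y.2 fun e => h (Subtype.ext e)⟩)
    exact ⟨g, fun b hb => (DFunLike.congr_fun hg (⟨b, hb⟩ : T)).symm⟩

theorem isSimpleGroup_of_isFraisseLimit [Countable M] {p₁ p₂ p₃ : C}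
    (H : IsPrioritised (Allowed S) p₁ p₂ p₃) (h : IsFraisseLimit (Forbc S) M) :
    IsSimpleGroup (M ≃[colourLanguage C] M) := by
  have : Nonempty C := ⟨p₁⟩
  obtain ⟨col, hM, hc⟩ := exists_isColouring_of_isFraisseLimit h
  exact (isGenericColouring_of_isFraisseLimit h hM hc H).isSimpleGroup H
    isClosedAction_automorphismGroup

end AutomorphismGroup

theorem mainTheorem1 :
    (∀ S ∈ cherlinList₃,
      (∃ (M : Type u) (_ : (colourLanguage Colour₃).Structure M) (_ : Countable M),
        IsFraisseLimit (Forbc S) M) ∧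
      ∀ (M : Type u) [(colourLanguage Colour₃).Structure M] [Countable M],
        IsFraisseLimit (Forbc S) M → IsSimpleGroup (M ≃[colourLanguage Colour₃] M)) ∧
    (∀ S ∈ cherlinList₄,
      (∃ (M : Type u) (_ : (colourLanguage Colour₄).Structure M) (_ : Countable M),
        IsFraisseLimit (Forbc S) M) ∧
      ∀ (M : Type u) [(colourLanguage Colour₄).Structure M] [Countable M],
        IsFraisseLimit (Forbc S) M → IsSimpleGroup (M ≃[colourLanguage Colour₄] M)) := by
  constructor <;> intro S hS
  · obtain ⟨p₁, p₂, p₃, H⟩ := exists_isPrioritised_of_mem_cherlinList₃ S hS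
    exact ⟨exists_isFraisseLimit H, fun _ => isSimpleGroup_of_isFraisseLimit H⟩
  · obtain ⟨p₁, p₂, p₃, H⟩ := exists_isPrioritised_of_mem_cherlinList₄ S hS
    exact ⟨exists_isFraisseLimit H, fun _ => isSimpleGroup_of_isFraisseLimit H⟩
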